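/- Let $n=d/2\ge 0$ be an integer and let $h(t)=h_0+h_1t+\dots+h_{2n}t^{2n}$ be reciprocal, $h_k=h_{2n-k}$. Its gamma polynomial $\gamma(t)=\sum_{i=0}^n\gamma_it^i$ is defined by $h(t)=\sum_{i=0}^n\gamma_i\,t^i(1+t)^{2n-2i}$. Let $T_j$ be the Chebyshev polynomials of the first kind. For a finite simplicial complex $\Delta$ (the empty set being a face) let $f_\Delta(t)=\sum_{\sigma\in\Delta}t^{|\sigma|}$ and $F_\Delta(x)=f_\Delta\left(\frac{x-1}{2}\right)$. A Tchebyshev triangulation (subdivision) $T(\Delta)$ is obtained by numbering the edges $e_1,\dots,e_m$ of $\Delta$ in any order and performing successively, for $i=1,\dots,m$, the stellar subdivision at $e_i$ with a new vertex (the midpoint of $e_i$). **Part 1.** Let $h\in\mathbb R[t]$. Suppose that $F_\Delta(t)=h_n+\sum_{j=1}^n2h_{n-j}t^j$ for a finite simplicial complex $\Delta$, i.e. $(h_n,2h_{n-1},\dots,2h_0)$ are the coefficients of $F_\Delta$. Then every Tchebyshev triangulation $T$ of the $n$-skeleton $\Delta^{\le n}$ satisfies $$F_T(u)=(2u+2)^{n}\,\gamma\!\left(\tfrac1{2u+2}\right),$$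 and $f_T(u)=F_T(2u+1)$ is obtained from the right-hand side by the substitution $u\mapsto 2u+1$. **Part 2.** Let $h\in\mathbb R[t]$ and, for a tuple $(a_0,\dots,a_n)$ (the coefficients in degrees $0,\dots,n$ of a reciprocal polynomial of degree $2n$), put $g_a(u)=a_n+2\sum_{j=1}^na_{n-j}T_j(u/2)$. Let $g=g_a$ for $a=(h_0,\dots,h_n)$, and let $\tilde g=g_{\tilde a}$ for the reversed tuple $\tilde a=(\tfrac12h_n,h_{n-1},\dots,h_1,2h_0)$ (for $n=0$: $\tilde a=(h_0)$). Let $A$ be the $(n+1)\times(n+1)$ change of basis matrix that takes the coefficients of a polynomial of degree $\le n$ in the basis $1,u,\dots,u^n$ to its coefficients in the basis $T_0,\dots,T_n$, and let $\tilde v$ be the vector of coefficients of $\tilde g(2u)$. Then $g(2u)$ is the $F$-polynomial of a Tchebyshev triangulation of some finite simplicial complex if and only if the entries of $A\tilde v$ in reverse order are the coefficients (in degrees $0,\dots,n$) of the $F$-polynomial of some finite simplicial complex. Moreover, for every finite simplicial complex $\Delta$ and every Tchebyshev triangulation $T$ of $\Delta$, $F_T(u)=g(2u)$ if and only if $A\tilde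 v$ in reverse order is the coefficient vector of $F_\Delta$. **Part 3.** Let $h\in\mathbb Z[t]$ and let $V=\mathbb C^2$ be the standard representation of $\mathfrak{sl}(2,\mathbb C)$. In the Grothendieck ring $K_0(\mathrm{Rep}(\mathfrak{sl}(2,\mathbb C)))$ of finite-dimensional representations, the value at $u=[V]$ of the derivative $$\frac{d}{du}\left[(u+2)^n\,\gamma\!\left(\tfrac1{u+2}\right)\right]\in\mathbb Z[u]$$ is $\sum_{j=1}^n j\,h_{n-j}\,[\mathrm{Sym}^{j-1}V]$. If all $h_k\ge0$, it is the class of the representation $\bigoplus_{j=1}^n(\mathrm{Sym}^{j-1}V)^{\oplus j h_{n-j}}$. Here $\mathrm{Sym}^{j-1}V$ $(1\le j\le n)$ is irreducible of dimension $j\le n=d/2$. -/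

import Mathlib

open Polynomial
open scoped TensorProduct DirectSum

noncomputable section

namespace GammaCheb

/-! ### Reciprocal polynomials and their gamma polynomials -/

/-- `h = h_0 + h_1 t + ⋯ + h_{2n} t^{2n}` is reciprocal of (formal) degree `2n`. -/
def IsReciprocal {R : Type*} [CommRing R] (n : ℕ) (h : R[X]) : Prop :=
  h.natDegree ≤ 2 * n ∧ ∀ k ≤ 2 * n, h.coeff k = h.coeff (2 * n - k)

/-- `γ = γ_0 + ⋯ + γ_n t^n` satisfies `h(t) = ∑_{i ≤ n} γ_i t^i (1 + t)^{2n - 2i}`. -/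
def IsGammaPolynomial {R : Type*} [CommRing R] (n : ℕ) (h γ : R[X]) : Prop :=
  γ.natDegree ≤ n ∧
    h = ∑ i ∈ Finset.range (n + 1), C (γ.coeff i) * X ^ i * (1 + X) ^ (2 * n - 2 * i)

theorem IsReciprocal.exists_gamma {R : Type*} [CommRing R] (n : ℕ) :
    ∀ h : R[X], IsReciprocal n h → ∃ γ, IsGammaPolynomial n h γ := by
  induction n with
  | zero =>
    intro h hh
    refine ⟨C (h.coeff 0), by simp, ?_⟩
    simpa using Polynomial.eq_C_of_natDegree_le_zero (by simpa using hh.1)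
  | succ n ih =>
    intro h hh
    have hcoeff : ∀ k, ((1 + X : R[X]) ^ (2 * (n + 1))).coeff k = ((2 * (n + 1)).choose k : R) :=
      fun k => by rw [Polynomial.coeff_one_add_X_pow]
    set q : R[X] := h - C (h.coeff 0) * (1 + X) ^ (2 * (n + 1)) with hq
    have hqc : ∀ k, q.coeff k = h.coeff k - h.coeff 0 * ((2 * (n + 1)).choose k : R) := by
      intro k; simp only [hq, coeff_sub, coeff_C_mul, hcoeff]
    have hbig : ∀ k, 2 * (n + 1) < k → h.coeff k = 0 := fun k hk =>
      coeff_eq_zero_of_natDegree_lt (lt_of_le_of_lt hh.1 hk)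
    have hq0 : q.coeff 0 = 0 := by rw [hqc]; simp
    have hqrec : ∀ k ≤ 2 * (n + 1), q.coeff k = q.coeff (2 * (n + 1) - k) := by
      intro k hk
      rw [hqc, hqc, hh.2 k hk, Nat.choose_symm hk]
    have hqbig : ∀ k, 2 * n + 1 < k → q.coeff k = 0 := by
      intro k hk
      rcases Nat.lt_or_ge (2 * (n + 1)) k with h1 | h1
      · rw [hqc, hbig k h1, Nat.choose_eq_zero_of_lt h1]; simp
      · have : k = 2 * (n + 1) := by omega
        rw [hqrec k h1, this, Nat.sub_self, hq0]
    have hq' : IsReciprocal n q.divX := by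
      refine ⟨?_, ?_⟩
      · rw [natDegree_le_iff_coeff_eq_zero]
        intro k hk
        rw [coeff_divX]
        exact hqbig _ (by omega)
      · intro k hk
        rw [coeff_divX, coeff_divX, hqrec (k + 1) (by omega)]
        congr 1
        omega
    obtain ⟨γ, hγ, hsum⟩ := ih _ hq'
    refine ⟨C (h.coeff 0) + X * γ, ?_, ?_⟩
    · refine (natDegree_add_le _ _).trans (max_le (by simp) ?_)
      refine natDegree_mul_le.trans ?_
      have := natDegree_X_le (R := R)
      omega
    · rw [Finset.sum_range_succ']
      have e1 : h = X * q.divX + C (h.coeff 0) * (1 + X) ^ (2 * (n + 1)) := by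
        have := X_mul_divX_add q
        rw [hq0, C_0, add_zero] at this
        rw [this, hq]; ring
      have e2 : ∀ i ∈ Finset.range (n + 1),
          C ((C (h.coeff 0) + X * γ).coeff (i + 1)) * X ^ (i + 1)
            * (1 + X : R[X]) ^ (2 * (n + 1) - 2 * (i + 1))
          = X * (C (γ.coeff i) * X ^ i * (1 + X) ^ (2 * n - 2 * i)) := by
        intro i _
        have : 2 * (n + 1) - 2 * (i + 1) = 2 * n - 2 * i := by omega
        rw [this]
        simp only [coeff_add, coeff_C_succ, zero_add, coeff_X_mul]
        ring
      rw [Finset.sum_congr rfl e2, ← Finset.mul_sum, ← hsum]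
      simpa using e1

theorem IsGammaPolynomial.unique {R : Type*} [CommRing R] (n : ℕ) :
    ∀ h γ γ' : R[X], IsGammaPolynomial n h γ → IsGammaPolynomial n h γ' → γ = γ' := by
  intro h γ γ' h1 h2
  have key : ∀ k ≤ n, γ.coeff k = γ'.coeff k := by
    intro k
    induction k using Nat.strong_induction_on with
    | _ k ih =>
      intro hk
      have hz : ∑ i ∈ Finset.range (n + 1),
          C (γ.coeff i - γ'.coeff i) * X ^ i * (1 + X : R[X]) ^ (2 * n - 2 * i) = 0 := by
        simp only [C_sub, sub_mul, Finset.sum_sub_distrib]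
        rw [← h1.2, ← h2.2, sub_self]
      have hc := congrArg (fun p : R[X] => p.coeff k) hz
      simp only [finsetSum_coeff, coeff_zero] at hc
      rw [Finset.sum_eq_single k] at hc
      · rw [mul_assoc, coeff_C_mul] at hc
        have e : ((X : R[X]) ^ k * (1 + X) ^ (2 * n - 2 * k)).coeff k = 1 := by
          have := coeff_X_pow_mul ((1 + X : R[X]) ^ (2 * n - 2 * k)) k 0
          rw [zero_add] at this
          rw [this, coeff_one_add_X_pow]; simp
        rw [e, mul_one] at hc
        exact sub_eq_zero.mp hc
      · intro i hi hik
        rcases lt_or_gt_of_ne hik with hlt | hgt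
        · rw [ih i hlt (by omega), sub_self]; simp
        · rw [mul_assoc, coeff_C_mul, coeff_X_pow_mul']
          simp [not_le.mpr hgt]
      · intro hnot
        exact absurd (Finset.mem_range.mpr (by omega)) hnot
  ext k
  rcases Nat.lt_or_ge n k with hk | hk
  · rw [coeff_eq_zero_of_natDegree_lt (lt_of_le_of_lt h1.1 hk),
      coeff_eq_zero_of_natDegree_lt (lt_of_le_of_lt h2.1 hk)]
  · exact key k hk

/-- The gamma polynomial `γ(t)` of a reciprocal polynomial of degree `2n`; it is the only polynomial
with the property `IsGammaPolynomial n h`, by `IsGammaPolynomial.unique`. -/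
def gammaPoly {R : Type*} [CommRing R] (n : ℕ) (h : R[X]) (hh : IsReciprocal n h) : R[X] :=
  (hh.exists_gamma n h).choose

theorem gammaPoly_spec {R : Type*} [CommRing R] (n : ℕ) (h : R[X]) (hh : IsReciprocal n h) :
    IsGammaPolynomial n h (gammaPoly n h hh) :=
  (hh.exists_gamma n h).choose_spec

/-- For a polynomial `γ` of degree at most `n` and a polynomial `p`, the polynomial
`p(u)^n γ(1 / p(u))`; here `Polynomial.reflect n γ` is `x^n γ(1/x)`. -/
def shiftedReciprocal {R : Type*} [CommRing R] (n : ℕ) (γ p : R[X]) : R[X] :=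
  (Polynomial.reflect n γ).comp p

/-- `g(u) = a_n + ∑_{j=1}^n 2 a_{n-j} T_j(u/2)`, the Chebyshev expansion attached to the reciprocal
polynomial of degree `2n` whose coefficients in degrees `0, …, n` are `a_0, …, a_n`. -/
def chebExpansion (n : ℕ) (a : ℕ → ℝ) : ℝ[X] :=
  C (a n) + ∑ j ∈ Finset.Icc 1 n,
    C (2 * a (n - j)) * (Chebyshev.T ℝ (j : ℤ)).comp (C (1 / 2) * X)

/-- The basis `T_0, T_1, T_2, …` of `ℝ[X]`. -/
def chebBasis : Module.Basis ℕ ℝ ℝ[X] :=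
  (Chebyshev.chebyshevTsequence ℝ).basis fun i =>
    (leadingCoeff_ne_zero.mpr ((Chebyshev.chebyshevTsequence ℝ).ne_zero i)).isUnit

theorem chebBasis_apply (j : ℕ) : chebBasis j = Chebyshev.T ℝ (j : ℤ) :=
  Polynomial.Sequence.basis_eq_self _ _ _

/-- The change of basis matrix from `1, x, …, x^n` to `T_0, …, T_n`: its column `i` holds the
coordinates of `x^i` in the Chebyshev basis. -/
def chebMatrix (n : ℕ) : Matrix (Fin (n + 1)) (Fin (n + 1)) ℝ :=
  Matrix.of fun j i => chebBasis.repr (X ^ (i : ℕ)) (j : ℕ)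

/-- The vector of coefficients in degrees `0, …, n`. -/
def coeffVec (n : ℕ) (p : ℝ[X]) : Fin (n + 1) → ℝ := fun i => p.coeff i

/-- The polynomial with a given vector of coefficients in degrees `0, …, n`. -/
def ofCoeffVec (n : ℕ) (w : Fin (n + 1) → ℝ) : ℝ[X] := ∑ i, C (w i) * X ^ (i : ℕ)

/-- From `h_0, …, h_n`, the reversed tuple `(h_n / 2, h_{n-1}, …, h_1, 2 h_0)` (and `(h_0)` if
`n = 0`). The factors at the ends make up for the constant term of the Chebyshev expansion, the
only one that does not carry a factor `2`. -/
def reversedTuple (n : ℕ) (h : ℕ → ℝ) : ℕ → ℝ := fun k =>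
  (if k = 0 then 1 / 2 else 1) * (if k = n then 2 else 1) * h (n - k)

/-! ### Simplicial complexes and Tchebyshev triangulations

A simplicial complex on a vertex set inside `V` is a `PreAbstractSimplicialComplex V`, whose `faces`
are the nonempty faces. The empty face belongs to every complex. -/

/-- The `f`-polynomial `∑_σ t^{|σ|}` of a finite complex; the summand `1` is the empty face. -/
def fPoly {V : Type*} (K : PreAbstractSimplicialComplex V) : ℝ[X] :=
  1 + ∑ᶠ s ∈ K.faces, X ^ s.card

/-- The `F`-polynomial `F_K(x) = f_K((x - 1)/2)`. -/
def FPoly {V : Type*} (K : PreAbstractSimplicialComplex V) : ℝ[X] :=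
  (fPoly K).comp (C (1 / 2) * (X - 1))

/-- The subcomplex of all faces of dimension at most `k`. -/
def skeleton {V : Type*} (k : ℕ) (K : PreAbstractSimplicialComplex V) :
    PreAbstractSimplicialComplex V where
  faces := {s | s ∈ K.faces ∧ s.card ≤ k + 1}
  isRelLowerSet_faces := fun _ hs =>
    ⟨(K.isRelLowerSet_faces hs.1).1, fun _ hts ht =>
      ⟨(K.isRelLowerSet_faces hs.1).2 hts ht, (Finset.card_le_card hts).trans hs.2⟩⟩

open Classical in
/-- The stellar subdivision of `K` at the face `e`, with new vertex `w`: the faces that contain `e`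
are replaced by the faces `σ ∪ {w}`, where `σ` (possibly empty) does not contain `e` and
`σ ∪ e` is a face. -/
def stellar {W : Type*} (K : PreAbstractSimplicialComplex W) (e : Finset W) (w : W) :
    PreAbstractSimplicialComplex W where
  faces := {s | s ∈ K.faces ∧ ¬ e ⊆ s} ∪
    {s | ∃ σ : Finset W, ¬ e ⊆ σ ∧ σ ∪ e ∈ K.faces ∧ s = insert w σ}
  isRelLowerSet_faces := by
    rintro s (⟨hs, hes⟩ | ⟨σ, heσ, hσ, rfl⟩)
    · exact ⟨(K.isRelLowerSet_faces hs).1, fun t hts ht =>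
        Or.inl ⟨(K.isRelLowerSet_faces hs).2 hts ht, fun h => hes (h.trans hts)⟩⟩
    · refine ⟨Finset.insert_nonempty _ _, fun t hts ht => ?_⟩
      have hene : e.Nonempty := by
        rw [Finset.nonempty_iff_ne_empty]
        rintro rfl
        exact heσ (Finset.empty_subset _)
      by_cases hw : w ∈ t
      · refine Or.inr ⟨t ∩ σ, fun h => heσ (h.trans Finset.inter_subset_right), ?_, ?_⟩
        · refine (K.isRelLowerSet_faces hσ).2
            (Finset.union_subset_union_left Finset.inter_subset_right)
            (hene.mono Finset.subset_union_right)
        · ext x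
          have := @hts x
          simp only [Finset.mem_insert, Finset.mem_inter] at this ⊢
          constructor
          · intro hx
            rcases this hx with h | h
            · exact Or.inl h
            · exact Or.inr ⟨hx, h⟩
          · rintro (rfl | h)
            · exact hw
            · exact h.1
      · have hsub : t ⊆ σ := (Finset.subset_insert_iff_of_notMem hw).mp hts
        exact Or.inl ⟨(K.isRelLowerSet_faces hσ).2 (hsub.trans Finset.subset_union_left) ht,
          fun h => heσ (h.trans hsub)⟩

open Classical in
/-- Starting from `K`, subdivide successively at the edges in the list `l`. The new vertex
subdividing the edge `e` of `K` is `Sum.inr e`. -/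
def subdivideEdges {V : Type*} (K : PreAbstractSimplicialComplex V) (l : List (Finset V)) :
    PreAbstractSimplicialComplex (V ⊕ Finset V) :=
  l.foldl (fun L e => stellar L (e.image Sum.inl) (Sum.inr e)) (K.map Sum.inl)

/-- `L` is a Tchebyshev triangulation `T(K)` of `K`: it arises by numbering the edges of `K` in some
order `e_1, …, e_m` and taking the stellar subdivisions at `e_1, …, e_m` one after another. -/
def IsTchebyshevTriangulation {V : Type*} (K : PreAbstractSimplicialComplex V)
    (L : PreAbstractSimplicialComplex (V ⊕ Finset V)) : Prop :=
  ∃ l : List (Finset V), l.Nodup ∧ (∀ e, e ∈ l ↔ e ∈ K.faces ∧ e.card = 2) ∧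
    L = subdivideEdges K l

/-- `p` is the `F`-polynomial of some finite simplicial complex. -/
def IsFPolynomial (p : ℝ[X]) : Prop :=
  ∃ (V : Type) (K : PreAbstractSimplicialComplex V), K.faces.Finite ∧ FPoly K = p

/-- `p` is the `F`-polynomial of a Tchebyshev triangulation of some finite simplicial complex. -/
def IsTchebyshevFPolynomial (p : ℝ[X]) : Prop :=
  ∃ (V : Type) (K : PreAbstractSimplicialComplex V) (L : PreAbstractSimplicialComplex (V ⊕ Finset V)),
    K.faces.Finite ∧ IsTchebyshevTriangulation K L ∧ FPoly L = p

/-! ### The Grothendieck ring of finite-dimensional representations of `sl(2, ℂ)` -/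

attribute [local instance 100] LieRing.ofAssociativeRing

/-- The Lie algebra `sl(2, ℂ)`. -/
abbrev sl2 : Type := LieAlgebra.SpecialLinear.sl (Fin 2) ℂ

/-- A finite-dimensional representation of `sl(2, ℂ)`. -/
structure SL2Rep : Type 1 where
  carrier : Type
  [addCommGroup : AddCommGroup carrier]
  [module : Module ℂ carrier]
  [lieRingModule : LieRingModule sl2 carrier]
  [lieModule : LieModule ℂ sl2 carrier]
  [finite : Module.Finite ℂ carrier]

namespace SL2Rep

attribute [instance] addCommGroup module lieRingModule lieModule finite

instance : CoeSort SL2Rep Type := ⟨carrier⟩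

/-- The representation given by a homomorphism of Lie algebras `sl(2, ℂ) → gl(W)`. -/
def ofHom {W : Type} [AddCommGroup W] [Module ℂ W] [Module.Finite ℂ W]
    (ρ : sl2 →ₗ⁅ℂ⁆ Module.End ℂ W) : SL2Rep :=
  letI := LieRingModule.compLieHom W ρ
  haveI := LieModule.compLieHom W ρ
  { carrier := W }

/-- The tensor product, with `X` acting by `X ⊗ 1 + 1 ⊗ X`. -/
def tensor (M N : SL2Rep) : SL2Rep where
  carrier := M ⊗[ℂ] N

/-- The trivial one-dimensional representation. -/
def trivial : SL2Rep := ofHom (W := ℂ) 0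

/-- The finite direct sum. -/
def directSum {ι : Type} [Fintype ι] (M : ι → SL2Rep) : SL2Rep where
  carrier := ⨁ i, M i

/-- The standard representation `V = ℂ²`. -/
def std : SL2Rep :=
  ofHom (W := Fin 2 → ℂ)
    ((lieEquivMatrix' (R := ℂ) (n := Fin 2)).symm.toLieHom.comp
      (LieAlgebra.SpecialLinear.sl (Fin 2) ℂ).incl)

/-- The derivation of `Sym(V) = ℂ[x_0, x_1]` that extends the action of the matrix `A` on
`V = ⟨x_0, x_1⟩`, so that `x_j ↦ ∑_i A_{ij} x_i`. -/
def symDerivation (A : Matrix (Fin 2) (Fin 2) ℂ) :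
    Derivation ℂ (MvPolynomial (Fin 2) ℂ) (MvPolynomial (Fin 2) ℂ) :=
  MvPolynomial.mkDerivation ℂ fun j => ∑ i, MvPolynomial.C (A i j) * MvPolynomial.X i

theorem symDerivation_lie (A B : Matrix (Fin 2) (Fin 2) ℂ) :
    symDerivation ⁅A, B⁆ = ⁅symDerivation A, symDerivation B⁆ := by
  refine MvPolynomial.derivation_ext fun j => ?_
  simp only [symDerivation, Derivation.commutator_apply, MvPolynomial.mkDerivation_X,
    Ring.lie_def, Matrix.sub_apply, Matrix.mul_apply, Fin.sum_univ_two, map_add, map_sub, map_mul,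
    Derivation.leibniz, MvPolynomial.derivation_C, smul_eq_mul]
  ring

theorem symDerivation_isHomogeneous (A : Matrix (Fin 2) (Fin 2) ℂ) (k : ℕ)
    (p : MvPolynomial (Fin 2) ℂ) (hp : p.IsHomogeneous k) :
    (symDerivation A p).IsHomogeneous k := by
  have e : symDerivation A
      = ∑ j, symDerivation A (MvPolynomial.X j) • MvPolynomial.pderiv (R := ℂ) j := by
    refine MvPolynomial.derivation_ext fun j => ?_
    fin_cases j <;> simp [Fin.sum_univ_two]
  have e1 : ∀ j, (symDerivation A (MvPolynomial.X j)).IsHomogeneous 1 := by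
    intro j
    simp only [symDerivation, MvPolynomial.mkDerivation_X]
    refine MvPolynomial.IsHomogeneous.sum _ _ _ fun i _ => ?_
    simpa using (MvPolynomial.isHomogeneous_C (Fin 2) (A i j)).mul
      (MvPolynomial.isHomogeneous_X ℂ i)
  rcases Nat.eq_zero_or_pos k with rfl | hk
  · have hp0 : p = MvPolynomial.C (p.coeff 0) := by
      refine MvPolynomial.totalDegree_eq_zero_iff_eq_C.mp ?_
      exact Nat.le_zero.mp hp.totalDegree_le
    rw [hp0, MvPolynomial.derivation_C]
    exact MvPolynomial.isHomogeneous_zero _ _ _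
  · rw [e, Fin.sum_univ_two]
    simp only [Derivation.add_apply, Derivation.smul_apply, smul_eq_mul]
    have hd : ∀ j : Fin 2,
        (symDerivation A (MvPolynomial.X j) * MvPolynomial.pderiv j p).IsHomogeneous k := by
      intro j
      have h2 := (e1 j).mul (hp.pderiv (i := j))
      rwa [Nat.add_sub_cancel' hk] at h2
    exact (hd 0).add (hd 1)

instance symPow_finite (k : ℕ) :
    Module.Finite ℂ (MvPolynomial.homogeneousSubmodule (Fin 2) ℂ k) :=
  Module.Finite.iff_fg.mpr (MvPolynomial.homogeneousSubmodule_fg _ _ k)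

/-- The symmetric power `Sym^k V` of the standard representation: the homogeneous polynomials of
degree `k` in the basis `x_0, x_1` of `V`, on which `sl(2, ℂ)` acts by derivations. -/
def symPow (k : ℕ) : SL2Rep :=
  ofHom (W := MvPolynomial.homogeneousSubmodule (Fin 2) ℂ k)
    { toFun := fun A => (symDerivation A.1).toLinearMap.restrict fun p hp =>
        symDerivation_isHomogeneous A.1 k p hp
      map_add' := fun A B => by
        refine LinearMap.ext fun p => Subtype.ext ?_
        have : symDerivation (A + B).1 = symDerivation A.1 + symDerivation B.1 := by
          refine MvPolynomial.derivation_ext fun j => ?_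
          simp [symDerivation, Fin.sum_univ_two]
          ring
        exact congrArg (fun D => D p.1) this
      map_smul' := fun c A => by
        refine LinearMap.ext fun p => Subtype.ext ?_
        have : symDerivation (c • A).1 = c • symDerivation A.1 := by
          refine MvPolynomial.derivation_ext fun j => ?_
          simp [symDerivation, Fin.sum_univ_two, MvPolynomial.smul_eq_C_mul]
          ring
        exact congrArg (fun D => D p.1) this
      map_lie' := fun {A B} => by
        refine LinearMap.ext fun p => Subtype.ext ?_
        have : symDerivation (⁅A, B⁆ : sl2).1 = ⁅symDerivation A.1, symDerivation B.1⁆ := by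
          rw [← symDerivation_lie]; rfl
        have h := congrArg (fun D => D p.1) this
        rw [Derivation.commutator_apply] at h
        exact h }

/-- Isomorphism of representations. -/
instance isoSetoid : Setoid SL2Rep where
  r M N := Nonempty (M ≃ₗ⁅ℂ, sl2⁆ N)
  iseqv :=
    ⟨fun _ => ⟨LieModuleEquiv.refl⟩, fun ⟨e⟩ => ⟨e.symm⟩, fun ⟨e⟩ ⟨f⟩ => ⟨e.trans f⟩⟩

/-- A linear isomorphism commuting with the action. -/
def mkEquiv {M N : Type} [AddCommGroup M] [Module ℂ M] [LieRingModule sl2 M]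
    [AddCommGroup N] [Module ℂ N] [LieRingModule sl2 N] (e : M ≃ₗ[ℂ] N)
    (h : ∀ (x : sl2) (m : M), e ⁅x, m⁆ = ⁅x, e m⁆) : M ≃ₗ⁅ℂ, sl2⁆ N :=
  { e with map_lie' := fun {x m} => h x m }

def tensorCongr {M M' N N' : SL2Rep} (e : M ≃ₗ⁅ℂ, sl2⁆ M') (f : N ≃ₗ⁅ℂ, sl2⁆ N') :
    M ⊗[ℂ] N ≃ₗ⁅ℂ, sl2⁆ M' ⊗[ℂ] N' :=
  mkEquiv (TensorProduct.congr e.toLinearEquiv f.toLinearEquiv) fun x t => by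
    induction t using TensorProduct.induction_on with
    | zero => simp
    | tmul m n =>
      have he : e ⁅x, m⁆ = ⁅x, e m⁆ := e.toLieModuleHom.map_lie x m
      have hf : f ⁅x, n⁆ = ⁅x, f n⁆ := f.toLieModuleHom.map_lie x n
      simp [TensorProduct.LieModule.lie_tmul_right, he, hf]
    | add s t hs ht => simp only [lie_add, map_add, hs, ht]

def tensorComm (M N : SL2Rep) : M ⊗[ℂ] N ≃ₗ⁅ℂ, sl2⁆ N ⊗[ℂ] M :=
  mkEquiv (TensorProduct.comm ℂ M N) fun x t => by
    induction t using TensorProduct.induction_on with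
    | zero => simp
    | tmul m n => simp [TensorProduct.LieModule.lie_tmul_right, add_comm]
    | add s t hs ht => simp only [lie_add, map_add, hs, ht]

def tensorAssoc (M N P : SL2Rep) : (M ⊗[ℂ] N) ⊗[ℂ] P ≃ₗ⁅ℂ, sl2⁆ M ⊗[ℂ] (N ⊗[ℂ] P) :=
  mkEquiv (TensorProduct.assoc ℂ M N P) fun x t => by
    induction t using TensorProduct.induction_on with
    | zero => simp
    | add s t hs ht => simp only [lie_add, map_add, hs, ht]
    | tmul s p =>
      induction s using TensorProduct.induction_on with
      | zero => simp
      | add s t hs ht => simp only [TensorProduct.add_tmul, lie_add, map_add, hs, ht]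
      | tmul m n =>
        simp [TensorProduct.LieModule.lie_tmul_right, TensorProduct.add_tmul,
          TensorProduct.tmul_add, add_assoc]

theorem lie_trivial (x : sl2) (c : trivial) : ⁅x, c⁆ = 0 := rfl

def tensorUnitLinear (M : SL2Rep) : trivial ⊗[ℂ] M ≃ₗ[ℂ] M :=
  TensorProduct.lid ℂ M

theorem tensorUnitLinear_tmul (M : SL2Rep) (c : trivial) (m : M) :
    tensorUnitLinear M (c ⊗ₜ[ℂ] m) = (show ℂ from c) • m := rfl

def tensorUnit (M : SL2Rep) : trivial ⊗[ℂ] M ≃ₗ⁅ℂ, sl2⁆ M :=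
  mkEquiv (tensorUnitLinear M) fun x t => by
    induction t using TensorProduct.induction_on with
    | zero => simp
    | tmul c m =>
      rw [TensorProduct.LieModule.lie_tmul_right, lie_trivial, TensorProduct.zero_tmul, zero_add,
        tensorUnitLinear_tmul, tensorUnitLinear_tmul, lie_smul]
    | add s t hs ht => simp only [lie_add, map_add, hs, ht]

/-- Isomorphism classes of finite-dimensional representations. -/
def IsoClass : Type 1 := Quotient isoSetoid

/-- Isomorphism classes form a commutative monoid under the tensor product. -/
instance : CommMonoid IsoClass where
  mul := Quotient.map₂ tensor fun _ _ ⟨e⟩ _ _ ⟨f⟩ => ⟨tensorCongr e f⟩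
  one := Quotient.mk _ trivial
  mul_assoc := by
    rintro ⟨M⟩ ⟨N⟩ ⟨P⟩
    exact Quotient.sound ⟨tensorAssoc M N P⟩
  mul_comm := by
    rintro ⟨M⟩ ⟨N⟩
    exact Quotient.sound ⟨tensorComm M N⟩
  one_mul := by
    rintro ⟨M⟩
    exact Quotient.sound ⟨tensorUnit M⟩
  mul_one := by
    rintro ⟨M⟩
    exact Quotient.sound ⟨(tensorComm M trivial).trans (tensorUnit M)⟩

/-- There is a short exact sequence `0 → M' → M → M'' → 0` of representations. -/
def IsShortExact (M' M M'' : SL2Rep) : Prop :=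
  ∃ (f : M' →ₗ⁅ℂ, sl2⁆ M) (g : M →ₗ⁅ℂ, sl2⁆ M''),
    Function.Injective f ∧ Function.Exact f g ∧ Function.Surjective g

/-- The generator attached to `M` of the free abelian group on the isomorphism classes. -/
def gen (M : SL2Rep) : FreeAbelianGroup IsoClass := FreeAbelianGroup.of (Quotient.mk _ M)

/-- The ideal generated by the relations `[M] = [M'] + [M'']`. Since `N ⊗ -` is exact over a field,
the additive subgroup generated by these elements is already an ideal, so that the quotient is the
usual Grothendieck group. -/
def relations : Ideal (FreeAbelianGroup IsoClass) :=
  Ideal.span {r | ∃ M' M M'' : SL2Rep, IsShortExact M' M M'' ∧ r = gen M - gen M' - gen M''}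

/-- The representation `⨁_{j=1}^n (Sym^{j-1} V)^{⊕ m_j}`. -/
def sumOfSymPow (n : ℕ) (m : ℕ → ℕ) : SL2Rep :=
  directSum fun p : Σ j : Fin n, Fin (m (j + 1)) => symPow p.1

end SL2Rep

/-- The Grothendieck ring `K_0(Rep(sl(2, ℂ)))` of finite-dimensional representations, with product
`[M] [N] = [M ⊗ N]`. -/
abbrev K0 : Type 1 := FreeAbelianGroup SL2Rep.IsoClass ⧸ SL2Rep.relations

/-- The class `[M]` in `K_0(Rep(sl(2, ℂ)))`. -/
def K0.mk (M : SL2Rep) : K0 := Ideal.Quotient.mk SL2Rep.relations (SL2Rep.gen M)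

end GammaCheb

end

/-! Parts 1 and 2 rest on one linear map Φ on `ℝ[X]`, X^j ↦ T_j (`chebTransform`): it carries the
F-polynomial of any finite complex to that of each of its Tchebyshev triangulations
(`FPoly_of_isTchebyshevTriangulation`). Count new simplices by the old simplex whose interior
contains them. The first subdivided edge of a simplex cuts its interior into three pieces, which
gives q_{k+2} = x(2q_{k+1} + q_k) for the interior count of a simplex with k + 2 vertices, whatever
the order of the edges. With y = (X - 1)/2, the images Φ(y^k) satisfy the same recurrence evaluated
at y, because T_{j+2} = 2X T_{j+1} - T_j.

For Part 1, put x = t + 1/t. Then (1 + t)²/t = x + 2 turns t^{-n}h(t) into (x + 2)^n γ(1/(x + 2)),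
while grouping t^j with t^{-j} gives h_n + ∑ h_{n-j} C_j(x). At x = 2u one has C_j(2u) = 2T_j(u), so
this is Φ of the polynomial with coefficients (h_n, 2h_{n-1}, …, 2h_0). The degree of F makes the
n-skeleton the whole complex.

For Part 2, Φ is bijective, and the Chebyshev coordinates of Φ(p) are the coefficients of p, so the
matrix A reads off a preimage under Φ. Passing to the reversed tuple reverses that coefficient
vector, and the final reversal undoes it.

For Part 3, C_j' = j S_{j-1}, and S_k([V]) = [Sym^k V], because the Koszul sequence 0 → Sym^k V → V
⊗ Sym^{k+1} V → Sym^{k+2} V → 0 is the recurrence S_{k+2} = X S_{k+1} - S_k in the Grothendieck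
ring. Only exactness is needed, not complete reducibility. -/

noncomputable section

namespace GammaCheb

/-! ### Face enumeration of iterated stellar subdivisions -/

section Stellar

variable {W : Type*}

open Classical in
/-- The simplices into which the stellar subdivision at `e` with new vertex `w` cuts the relative
interior of the simplex `s`. -/
def stellarPieces (e : Finset W) (w : W) (s : Finset W) : Finset (Finset W) :=
  if e ⊆ s then {σ ∈ s.powerset | ¬ e ⊆ σ ∧ σ ∪ e = s}.image (insert w) else {s}

open Classical in
theorem mem_stellarPieces {e : Finset W} {w : W} {s t : Finset W} :
    t ∈ stellarPieces e w s ↔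
      (t = s ∧ ¬ e ⊆ s) ∨ ∃ σ, ¬ e ⊆ σ ∧ σ ∪ e = s ∧ t = insert w σ := by
  unfold stellarPieces
  split_ifs with h
  · simp only [Finset.mem_image, Finset.mem_filter, Finset.mem_powerset, h, not_true_eq_false,
      and_false, false_or]
    constructor
    · rintro ⟨σ, ⟨-, h1, h2⟩, rfl⟩
      exact ⟨σ, h1, h2, rfl⟩
    · rintro ⟨σ, h1, h2, rfl⟩
      exact ⟨σ, ⟨h2 ▸ Finset.subset_union_left, h1, h2⟩, rfl⟩
  · simp only [Finset.mem_singleton, h, not_false_eq_true, and_true]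
    refine ⟨Or.inl, ?_⟩
    rintro (h1 | ⟨σ, -, h2, -⟩)
    · exact h1
    · exact absurd (h2 ▸ Finset.subset_union_right) h

/-- Grouping the new faces by carrier: an unsplit face carries itself, and `insert w σ` is carried
by `σ ∪ e`. -/
theorem stellar_faces (L : PreAbstractSimplicialComplex W) (e : Finset W) (w : W) :
    (stellar L e w).faces = ⋃ s ∈ L.faces, (stellarPieces e w s : Set (Finset W)) := by
  classical
  ext t
  simp only [stellar, Set.mem_union, Set.mem_ofPred_eq, Set.mem_iUnion, Finset.mem_coe,
    mem_stellarPieces, exists_prop]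
  constructor
  · rintro (⟨h1, h2⟩ | ⟨σ, h1, h2, rfl⟩)
    · exact ⟨t, h1, Or.inl ⟨rfl, h2⟩⟩
    · exact ⟨_, h2, Or.inr ⟨σ, h1, by congr!, by congr!⟩⟩
  · rintro ⟨s, hs, ⟨rfl, h⟩ | ⟨σ, h1, rfl, rfl⟩⟩
    · exact Or.inl ⟨hs, h⟩
    · exact Or.inr ⟨σ, h1, by convert hs, by congr!⟩

/-- The carrier can be recovered from a piece. A piece without `w` is its own carrier; from one with
`w`, erasing `w` gives σ, since `w` is new, and the carrier is `σ ∪ e`. -/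
theorem stellarPieces_pairwiseDisjoint {A : Set (Finset W)} {e : Finset W} {w : W}
    (hw : ∀ s ∈ A, w ∉ s) :
    A.PairwiseDisjoint fun s => (stellarPieces e w s : Set (Finset W)) := by
  classical
  intro s hs s' hs' hne
  refine Set.disjoint_left.mpr fun t ht ht' => hne ?_
  simp only [Finset.mem_coe, mem_stellarPieces] at ht ht'
  have aux : ∀ {σ u : Finset W}, σ ∪ e = u → w ∉ u → w ∉ σ := fun h1 h2 h3 =>
    h2 (h1 ▸ Finset.mem_union_left _ h3)
  rcases ht with ⟨rfl, -⟩ | ⟨σ, -, h2, rfl⟩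
  · rcases ht' with ⟨rfl, -⟩ | ⟨σ, -, h2, rfl⟩
    · rfl
    · exact absurd (Finset.mem_insert_self _ _) (hw _ hs)
  · rcases ht' with ⟨rfl, -⟩ | ⟨σ', -, h2', h3⟩
    · exact absurd (Finset.mem_insert_self _ _) (hw _ hs')
    · have h := congrArg (Finset.erase · w) h3
      simp only [Finset.erase_insert (aux h2 (hw _ hs)),
        Finset.erase_insert (aux h2' (hw _ hs'))] at h
      rw [← h2, ← h2', h]

theorem finite_stellar {L : PreAbstractSimplicialComplex W} (hL : L.faces.Finite)
    (e : Finset W) (w : W) : (stellar L e w).faces.Finite := by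
  rw [stellar_faces]
  exact hL.biUnion fun s _ => Finset.finite_toSet _

theorem finsum_stellar {M : Type*} [AddCommMonoid M] {L : PreAbstractSimplicialComplex W}
    (hL : L.faces.Finite) {e : Finset W} {w : W} (hw : ∀ s ∈ L.faces, w ∉ s)
    (f : Finset W → M) :
    ∑ᶠ t ∈ (stellar L e w).faces, f t
      = ∑ᶠ s ∈ L.faces, ∑ t ∈ stellarPieces e w s, f t := by
  rw [stellar_faces, finsum_mem_biUnion (stellarPieces_pairwiseDisjoint hw) hL
    fun s _ => Finset.finite_toSet _]
  simp only [finsum_mem_coe_finset]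

-- A set σ with σ ∪ {x, y} = s that does not contain both x and y is s with x, with y, or with both
-- removed.
open Classical in
theorem stellarPieces_pair {x y w : W} {s : Finset W} (hx : x ∈ s) (hy : y ∈ s) (hxy : x ≠ y) :
    stellarPieces {x, y} w s
      = {insert w (s.erase x), insert w (s.erase y), insert w ((s.erase x).erase y)} := by
  ext t
  simp only [mem_stellarPieces, Finset.mem_insert, Finset.mem_singleton]
  have hsub : ({x, y} : Finset W) ⊆ s := by
    simp [Finset.insert_subset_iff, hx, hy]
  constructor
  · rintro (⟨-, h⟩ | ⟨σ, h1, h2, rfl⟩)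
    · exact absurd hsub h
    · simp only [Finset.insert_subset_iff, Finset.singleton_subset_iff, not_and_or] at h1
      subst h2
      by_cases hxσ : x ∈ σ
      · have hyσ : y ∉ σ := by tauto
        refine Or.inr (Or.inl ?_)
        congr 1
        ext z; simp only [Finset.mem_erase, Finset.mem_union, Finset.mem_insert,
          Finset.mem_singleton]
        grind
      · by_cases hyσ : y ∈ σ
        · refine Or.inl ?_
          congr 1
          ext z; simp only [Finset.mem_erase, Finset.mem_union, Finset.mem_insert,
            Finset.mem_singleton]
          grind
        · refine Or.inr (Or.inr ?_)
          congr 1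
          ext z; simp only [Finset.mem_erase, Finset.mem_union, Finset.mem_insert,
            Finset.mem_singleton]
          grind
  · intro h
    right
    rcases h with rfl | rfl | rfl
    · refine ⟨s.erase x, fun h => by simpa using h (Finset.mem_insert_self x _), ?_, rfl⟩
      grind
    · refine ⟨s.erase y, fun h => by simpa using @h y (by simp), ?_, rfl⟩
      grind
    · refine ⟨(s.erase x).erase y, fun h => by simpa using @h y (by simp), ?_, rfl⟩
      grind

theorem sum_stellarPieces_pair {M : Type*} [AddCommMonoid M] [D : DecidableEq W] {x y w : W} {s : Finset W}
    (hx : x ∈ s) (hy : y ∈ s) (hxy : x ≠ y) (hw : w ∉ s) (f : Finset W → M) :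
    ∑ t ∈ stellarPieces {x, y} w s, f t
      = f (insert w (s.erase x)) + (f (insert w (s.erase y))
          + f (insert w ((s.erase x).erase y))) := by
  -- The pieces are built with classical decidability; leaving `D` arbitrary in the statement lets
  -- the formula apply to whatever instance occurs at the point of use.
  obtain rfl : D = fun a b => Classical.propDecidable _ := Subsingleton.elim _ _
  classical
  have hinj : ∀ {u v : Finset W}, w ∉ u → w ∉ v → insert w u = insert w v → u = v := by
    intro u v hu hv h
    have := congrArg (Finset.erase · w) h
    simpa only [Finset.erase_insert hu, Finset.erase_insert hv] using this
  have h1 : w ∉ s.erase x := fun h => hw (Finset.mem_of_mem_erase h)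
  have h2 : w ∉ s.erase y := fun h => hw (Finset.mem_of_mem_erase h)
  have h3 : w ∉ (s.erase x).erase y := fun h => h1 (Finset.mem_of_mem_erase h)
  rw [stellarPieces_pair hx hy hxy, Finset.sum_insert, Finset.sum_insert, Finset.sum_singleton]
  · rw [Finset.mem_singleton]
    intro h
    have := hinj h2 h3 h
    have hx' : x ∈ s.erase y := Finset.mem_erase.mpr ⟨hxy, hx⟩
    rw [this] at hx'
    simp at hx'
  · rw [Finset.mem_insert, Finset.mem_singleton]
    have hy' : y ∈ s.erase x := Finset.mem_erase.mpr ⟨hxy.symm, hy⟩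
    rintro (h | h)
    · rw [hinj h1 h2 h] at hy'
      simp at hy'
    · rw [hinj h1 h3 h] at hy'
      simp at hy'

end Stellar

/-! ### Interior counts for successive edge subdivisions -/

section Tchebyshev

variable {V : Type*}

/-- The polynomial counting the simplices into which successive stellar subdivisions at the edges
in a list cut the relative interior of a simplex. -/
def subdivisionWeight : List (Finset V) → Finset (V ⊕ Finset V) → ℝ[X]
  | [], s => X ^ s.card
  | e :: l, s => by
      classical
      exact ∑ t ∈ stellarPieces (e.image Sum.inl) (Sum.inr e) s, subdivisionWeight l t

-- Induction on the list with the complex varying. Freshness of the later midpoints is preserved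
-- because the only vertex added is `Sum.inr e`, and `e` does not recur in the list.
open Classical in
theorem finsum_foldl_stellar (l : List (Finset V)) :
    ∀ L : PreAbstractSimplicialComplex (V ⊕ Finset V), L.faces.Finite → l.Nodup →
      (∀ e ∈ l, ∀ s ∈ L.faces, Sum.inr e ∉ s) →
      ∑ᶠ s ∈ (l.foldl (fun L e => stellar L (e.image Sum.inl) (Sum.inr e)) L).faces,
          (X : ℝ[X]) ^ s.card
        = ∑ᶠ s ∈ L.faces, subdivisionWeight l s := by
  induction l with
  | nil => intros; simp [subdivisionWeight]
  | cons e l ih =>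
    intro L hL hl hfresh
    rw [List.nodup_cons] at hl
    rw [List.foldl_cons, ih _ (finite_stellar hL _ _) hl.2,
      finsum_stellar hL (hfresh e List.mem_cons_self)]
    · rfl
    · intro e' he' s hs
      have hne : e' ≠ e := fun h => hl.1 (h ▸ he')
      rw [stellar_faces] at hs
      simp only [Set.mem_iUnion, Finset.mem_coe, mem_stellarPieces, exists_prop] at hs
      obtain ⟨u, hu, ⟨rfl, -⟩ | ⟨σ, -, rfl, rfl⟩⟩ := hs
      · exact hfresh e' (List.mem_cons_of_mem _ he') _ hu
      · have := hfresh e' (List.mem_cons_of_mem _ he') _ hu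
        simp only [Finset.mem_union, not_or] at this
        simp [hne, this.1]

/-- The polynomials `q_k` counting the simplices in the interior of a Tchebyshev triangulation of a
simplex with `k` vertices. -/
def interiorPoly : ℕ → ℝ[X]
  | 0 => 1
  | 1 => X
  | k + 2 => X * (2 * interiorPoly (k + 1) + interiorPoly k)

-- Here `A` holds the original vertices of the simplex and `B` the midpoints already inserted. The
-- invariant is that every edge inside `A` is still to be subdivided and no midpoint in `B` belongs
-- to a pending edge. A pending edge inside `A` splits the simplex into three, each trading one or
-- both endpoints for the midpoint; any other edge leaves it intact. The result depends on the two
-- cardinalities alone, hence not on the order of the list.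
open Classical in
theorem subdivisionWeight_disjSum (l : List (Finset V)) :
    ∀ (A : Finset V) (B : Finset (Finset V)), l.Nodup → (∀ e ∈ l, e.card = 2) →
      (∀ e ⊆ A, e.card = 2 → e ∈ l) → (∀ e ∈ l, e ∉ B) →
      subdivisionWeight l (A.disjSum B) = X ^ B.card * interiorPoly A.card := by
  induction l with
  | nil =>
    intro A B _ _ hA _
    -- With nothing left to subdivide, `A` can contain no pair, so only the two base cases of
    -- `interiorPoly` occur.
    have hc : A.card ≤ 1 := by
      by_contra! h
      obtain ⟨e, he, hc⟩ := Finset.exists_subset_card_eq (show 2 ≤ A.card by omega)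
      exact absurd (hA e he hc) List.not_mem_nil
    rw [subdivisionWeight, Finset.card_disjSum]
    interval_cases A.card <;> simp [interiorPoly, pow_add, mul_comm]
  | cons e l ih =>
    intro A B hl hcard hA hB
    rw [List.nodup_cons] at hl
    have hcard' : ∀ e ∈ l, e.card = 2 := fun e' he' => hcard e' (List.mem_cons_of_mem _ he')
    by_cases heA : e ⊆ A
    · obtain ⟨a, b, hab, rfl⟩ := Finset.card_eq_two.mp (hcard e List.mem_cons_self)
      set w : Finset V := {a, b} with hw
      have ha : a ∈ A := heA (by simp [hw])
      have hb : b ∈ A := heA (by simp [hw])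
      have hwB : w ∉ B := hB w List.mem_cons_self
      -- A piece whose original vertices omit an endpoint of `w` no longer has `w` as an edge, so
      -- dropping `w` from the list and moving it to `B` preserves the invariant.
      have key : ∀ A' ⊆ A, ¬ w ⊆ A' →
          subdivisionWeight l (A'.disjSum (insert w B))
            = X ^ (B.card + 1) * interiorPoly A'.card := by
        intro A' hA' hwA'
        rw [ih A' (insert w B) hl.2 hcard', Finset.card_insert_of_notMem hwB]
        · intro e' he' hc
          rcases List.mem_cons.mp (hA e' (he'.trans hA') hc) with rfl | h
          · exact absurd he' hwA'
          · exact h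
        · intro e' he' h
          rcases Finset.mem_insert.mp h with rfl | h
          · exact hl.1 he'
          · exact hB e' (List.mem_cons_of_mem _ he') h
      have e1 : insert (Sum.inr w) ((A.disjSum B).erase (Sum.inl a))
          = (A.erase a).disjSum (insert w B) := by
        ext z; rcases z with z | z <;> simp
      have e2 : insert (Sum.inr w) ((A.disjSum B).erase (Sum.inl b))
          = (A.erase b).disjSum (insert w B) := by
        ext z; rcases z with z | z <;> simp
      have e3 : insert (Sum.inr w) (((A.disjSum B).erase (Sum.inl a)).erase (Sum.inl b))
          = ((A.erase a).erase b).disjSum (insert w B) := by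
        ext z; rcases z with z | z <;> simp
      have hsum := sum_stellarPieces_pair (w := Sum.inr w) (s := A.disjSum B)
        (Finset.inl_mem_disjSum.mpr ha) (Finset.inl_mem_disjSum.mpr hb)
        (fun h => hab (Sum.inl_injective h)) (fun h => hwB (Finset.inr_mem_disjSum.mp h))
        (subdivisionWeight l)
      have hstart : subdivisionWeight (w :: l) (A.disjSum B)
          = ∑ t ∈ stellarPieces {Sum.inl a, Sum.inl b} (Sum.inr w) (A.disjSum B),
              subdivisionWeight l t := by
        rw [subdivisionWeight]
        congr 2
        simp [hw, Finset.image_insert]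
      rw [hstart, hsum]
      have hb' : b ∈ A.erase a := Finset.mem_erase.mpr ⟨hab.symm, hb⟩
      obtain ⟨k, hk⟩ : ∃ k, A.card = k + 2 := by
        have := Finset.card_le_card heA
        rw [hcard w List.mem_cons_self] at this
        exact ⟨A.card - 2, by omega⟩
      have c1 : (A.erase a).card = k + 1 := by rw [Finset.card_erase_of_mem ha, hk]; rfl
      have c2 : (A.erase b).card = k + 1 := by rw [Finset.card_erase_of_mem hb, hk]; rfl
      have c3 : ((A.erase a).erase b).card = k := by rw [Finset.card_erase_of_mem hb', c1]; rfl
      have s1 : ¬ w ⊆ A.erase a := fun h => by simpa using h (show a ∈ w by simp [hw])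
      have s2 : ¬ w ⊆ A.erase b := fun h => by simpa using h (show b ∈ w by simp [hw])
      have s3 : ¬ w ⊆ (A.erase a).erase b := fun h => s1 (h.trans (Finset.erase_subset _ _))
      have k1 := key _ (Finset.erase_subset a A) s1
      have k2 := key _ (Finset.erase_subset b A) s2
      have k3 := key _ ((Finset.erase_subset b _).trans (Finset.erase_subset a A)) s3
      rw [← e1, c1] at k1
      rw [← e2, c2] at k2
      rw [← e3, c3] at k3
      rw [hk, interiorPoly]
      rw [k1, k2, k3]
      ring
    · have hnot : ¬ e.image (Sum.inl (β := Finset V)) ⊆ A.disjSum B := by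
        intro h
        refine heA fun x hx => ?_
        exact Finset.inl_mem_disjSum.mp (h (Finset.mem_image_of_mem _ hx))
      have : stellarPieces (e.image Sum.inl) (Sum.inr e) (A.disjSum B) = {A.disjSum B} := by
        rw [stellarPieces, if_neg hnot]
      rw [subdivisionWeight]
      refine Eq.trans (b := subdivisionWeight l (A.disjSum B)) ?_ ?_
      · refine Eq.trans ?_ (Finset.sum_singleton _ _)
        congr 1
      · refine ih A B hl.2 hcard' (fun e' he' hc => ?_)
          fun e' he' => hB e' (List.mem_cons_of_mem _ he')
        rcases List.mem_cons.mp (hA e' he' hc) with rfl | h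
        · exact absurd he' heA
        · exact h

/-- A face of the original complex starts with no midpoints, and all its edges are on the list
because faces are closed under nonempty subsets. -/
theorem fPoly_of_isTchebyshevTriangulation {K : PreAbstractSimplicialComplex V}
    (hK : K.faces.Finite) {L : PreAbstractSimplicialComplex (V ⊕ Finset V)}
    (hL : IsTchebyshevTriangulation K L) :
    fPoly L = 1 + ∑ᶠ s ∈ K.faces, interiorPoly s.card := by
  classical
  obtain ⟨l, hl, hmem, rfl⟩ := hL
  have hfaces : ∀ s : Finset V, s.image (Sum.inl (β := Finset V)) = s.disjSum ∅ := by
    intro s; ext z; rcases z with z | z <;> simp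
  rw [fPoly, subdivideEdges, finsum_foldl_stellar l _ _ hl]
  · congr 1
    change ∑ᶠ s ∈ (fun s : Finset V => s.image Sum.inl) '' K.faces, _ = _
    rw [finsum_mem_image]
    · refine finsum_mem_congr rfl fun s hs => ?_
      have := subdivisionWeight_disjSum l s ∅ hl (fun e he => ((hmem e).mp he).2)
        (fun e he hc => (hmem e).mpr ⟨(K.isRelLowerSet_faces hs).2 he
          (Finset.card_pos.mp (by omega)), hc⟩) (fun e _ => Finset.notMem_empty e)
      rw [← hfaces] at this
      simpa using this
    · intro s _ t _ h
      exact Finset.image_injective Sum.inl_injective h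
  · rintro e _ _ ⟨s, -, rfl⟩
    simp
  · exact hK.image _

theorem exists_isTchebyshevTriangulation (K : PreAbstractSimplicialComplex V)
    (hK : K.faces.Finite) : ∃ L, IsTchebyshevTriangulation K L := by
  have hfin : {e | e ∈ K.faces ∧ e.card = 2}.Finite := hK.subset fun e he => he.1
  exact ⟨_, hfin.toFinset.toList, Finset.nodup_toList _, fun e => by simp, rfl⟩

end Tchebyshev

/-! ### The Chebyshev transform of `F`-polynomials -/

/-- The linear map `X ^ j ↦ T_j`. -/
def chebTransform : ℝ[X] ≃ₗ[ℝ] ℝ[X] :=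
  (Polynomial.basisMonomials ℝ).equiv chebBasis (Equiv.refl ℕ)

theorem chebTransform_X_pow (j : ℕ) : chebTransform (X ^ j) = Chebyshev.T ℝ (j : ℤ) := by
  have := (Polynomial.basisMonomials ℝ).equiv_apply j chebBasis (Equiv.refl ℕ)
  simp only [coe_basisMonomials, monomial_one_right_eq_X_pow] at this
  rw [chebTransform, this, Equiv.refl_apply, chebBasis_apply]

theorem chebTransform_one : chebTransform 1 = 1 := by
  simpa using chebTransform_X_pow 0

theorem chebTransform_C_mul (c : ℝ) (p : ℝ[X]) :
    chebTransform (C c * p) = C c * chebTransform p := by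
  rw [← smul_eq_C_mul, map_smul, smul_eq_C_mul]

/-- This is why the matrix A inverts the transform. -/
theorem chebBasis_repr_chebTransform (p : ℝ[X]) (j : ℕ) :
    chebBasis.repr (chebTransform p) j = p.coeff j := by
  induction p using Polynomial.induction_on' with
  | add p q hp hq => simp only [map_add, Finsupp.add_apply, hp, hq, coeff_add]
  | monomial k c =>
    rw [← C_mul_X_pow_eq_monomial, chebTransform_C_mul, chebTransform_X_pow, ← chebBasis_apply,
      ← smul_eq_C_mul, map_smul, Module.Basis.repr_self, Finsupp.smul_single, smul_eq_mul,
      mul_one, Finsupp.single_apply, coeff_C_mul_X_pow]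
    simp only [eq_comm]

/-- On p = X^j both sides equal y T_{j+1} with y = (X - 1)/2: on the left by the three-term
recurrence of the T_j, on the right because 2Φ(py) = T_{j+1} - T_j. -/
theorem chebTransform_mul_sq (p : ℝ[X]) :
    chebTransform (p * (C (1 / 2) * (X - 1)) ^ 2)
      = C (1 / 2) * (X - 1) * (2 * chebTransform (p * (C (1 / 2) * (X - 1))) + chebTransform p) := by
  induction p using Polynomial.induction_on' with
  | add p q hp hq => simp only [add_mul, map_add, hp, hq]; ring
  | monomial j c =>
    have hC : (C (1 / 2) : ℝ[X]) * 2 = 1 := by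
      rw [← C_ofNat, ← C_mul]; norm_num
    have e1 : monomial j c * (C (1 / 2 : ℝ) * (X - 1)) ^ 2
        = C c * (C (1 / 2) * (C (1 / 2) * (X ^ (j + 2))) - C (1 / 2) * X ^ (j + 1)
            + C (1 / 2) * (C (1 / 2) * X ^ j)) := by
      rw [← C_mul_X_pow_eq_monomial]
      linear_combination (-(C c * X ^ j * C (1 / 2) * X)) * hC
    have e2 : monomial j c * (C (1 / 2 : ℝ) * (X - 1))
        = C c * (C (1 / 2) * X ^ (j + 1) - C (1 / 2) * X ^ j) := by
      rw [← C_mul_X_pow_eq_monomial]; ring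
    rw [e1, e2, ← C_mul_X_pow_eq_monomial]
    simp only [map_add, map_sub, chebTransform_C_mul, chebTransform_X_pow]
    have hT : Chebyshev.T ℝ ((j + 2 : ℕ) : ℤ)
        = 2 * X * Chebyshev.T ℝ ((j + 1 : ℕ) : ℤ) - Chebyshev.T ℝ (j : ℤ) := by
      push_cast; exact Chebyshev.T_add_two ℝ j
    rw [hT]
    linear_combination (C c * Chebyshev.T ℝ ((j + 1 : ℕ) : ℤ) * C (1 / 2) +
      C c * C (1 / 2) * Chebyshev.T ℝ (j : ℤ) * (X - 1)) * hC

/-- The previous identity with p = y^k is the recurrence of `interiorPoly` evaluated at y, so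
geometry and Chebyshev recurrence agree from k = 0, 1 onwards. -/
theorem chebTransform_half_pow : ∀ k : ℕ,
    chebTransform ((C (1 / 2) * (X - 1)) ^ k) = (interiorPoly k).comp (C (1 / 2) * (X - 1))
  | 0 => by simp [interiorPoly, chebTransform_one]
  | 1 => by
    have e : (C (1 / 2 : ℝ) * (X - 1)) ^ 1 = C (1 / 2) * X ^ 1 - C (1 / 2) * 1 := by ring
    rw [e, map_sub, chebTransform_C_mul, chebTransform_C_mul, chebTransform_X_pow,
      chebTransform_one]
    simp only [Nat.cast_one, Chebyshev.T_one, interiorPoly, X_comp]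
    ring
  | k + 2 => by
    rw [pow_add, chebTransform_mul_sq, ← pow_succ, chebTransform_half_pow (k + 1),
      chebTransform_half_pow k, interiorPoly]
    simp

theorem FPoly_of_isTchebyshevTriangulation {V : Type*} {K : PreAbstractSimplicialComplex V}
    (hK : K.faces.Finite) {L : PreAbstractSimplicialComplex (V ⊕ Finset V)}
    (hL : IsTchebyshevTriangulation K L) :
    FPoly L = chebTransform (FPoly K) := by
  rw [FPoly, FPoly, fPoly_of_isTchebyshevTriangulation hK hL, fPoly,
    finsum_mem_eq_finite_toFinset_sum _ hK, finsum_mem_eq_finite_toFinset_sum _ hK]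
  simp only [add_comp, one_comp, Polynomial.sum_comp, map_add, map_sum, X_pow_comp,
    chebTransform_one, chebTransform_half_pow]

/-! ### The gamma polynomial and the polynomials `C_j` -/

/-- The linear map `t ^ k ↦ C_{k-n}`, where `C_j(t + 1/t) = t^j + 1/t^j`. -/
def symmetrization (R : Type*) [CommRing R] (n : ℕ) : R[X] →ₗ[R] R[X] :=
  (Polynomial.basisMonomials R).constr R fun k => Chebyshev.C R ((k : ℤ) - n)

section Gamma

variable {R : Type*} [CommRing R]

theorem symmetrization_X_pow (n k : ℕ) :
    symmetrization R n (X ^ k) = Chebyshev.C R ((k : ℤ) - n) := by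
  have := (Polynomial.basisMonomials R).constr_basis R
    (fun k : ℕ => Chebyshev.C R ((k : ℤ) - n)) k
  simpa only [coe_basisMonomials, monomial_one_right_eq_X_pow, symmetrization] using this

theorem symmetrization_C_mul (n : ℕ) (c : R) (p : R[X]) :
    symmetrization R n (C c * p) = C c * symmetrization R n p := by
  rw [← smul_eq_C_mul, map_smul, smul_eq_C_mul]

/-- `symmetrization` stands for the division by t^n followed by t^j ↦ t^j + t^{-j}; a factor t
cancels against one more division. -/
theorem symmetrization_succ_X_mul (n : ℕ) (p : R[X]) :
    symmetrization R (n + 1) (X * p) = symmetrization R n p := by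
  induction p using Polynomial.induction_on' with
  | add p q hp hq => simp only [mul_add, map_add, hp, hq]
  | monomial k c =>
    have e : X * monomial k c = C c * X ^ (k + 1) := by
      rw [← C_mul_X_pow_eq_monomial]; ring
    rw [e, ← C_mul_X_pow_eq_monomial]
    simp only [symmetrization_C_mul, symmetrization_X_pow]
    congr 2; push_cast; ring

/-- (1 + t)²/t = x + 2 for x = t + 1/t, in the form C_{j+1} + C_{j-1} = x C_j. -/
theorem symmetrization_succ_one_add_X_sq_mul (n : ℕ) (p : R[X]) :
    symmetrization R (n + 1) ((1 + X) ^ 2 * p) = (X + 2) * symmetrization R n p := by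
  induction p using Polynomial.induction_on' with
  | add p q hp hq => simp only [mul_add, map_add, hp, hq]
  | monomial k c =>
    have e : (1 + X) ^ 2 * monomial k c
        = C c * X ^ k + (C c * X ^ (k + 1) + C c * X ^ (k + 1)) + C c * X ^ (k + 2) := by
      rw [← C_mul_X_pow_eq_monomial]; ring
    rw [e, ← C_mul_X_pow_eq_monomial]
    simp only [map_add, symmetrization_C_mul, symmetrization_X_pow]
    have h0 : ((k : ℤ) - ((n + 1 : ℕ) : ℤ)) = (k : ℤ) - n - 1 := by push_cast; ring
    have h1 : (((k + 1 : ℕ) : ℤ) - ((n + 1 : ℕ) : ℤ)) = (k : ℤ) - n := by push_cast; ring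
    have h2 : (((k + 2 : ℕ) : ℤ) - ((n + 1 : ℕ) : ℤ)) = (k : ℤ) - n + 1 := by push_cast; ring
    rw [h0, h1, h2, Chebyshev.C_add_one]
    ring

theorem symmetrization_gamma_term (i m : ℕ) :
    symmetrization R (i + m) (X ^ i * (1 + X) ^ (2 * m)) = 2 * (X + 2) ^ m := by
  induction i with
  | zero =>
    rw [pow_zero, one_mul, zero_add]
    induction m with
    -- The factor 2 enters here, as C_0 = 2.
    | zero => simpa using symmetrization_X_pow (R := R) 0 0
    | succ m ih =>
      rw [show (1 + X : R[X]) ^ (2 * (m + 1)) = (1 + X) ^ 2 * (1 + X) ^ (2 * m) by ring,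
        symmetrization_succ_one_add_X_sq_mul, ih]
      ring
  | succ i ih =>
    rw [show i + 1 + m = i + m + 1 by ring, show (X : R[X]) ^ (i + 1) * (1 + X) ^ (2 * m)
      = X * (X ^ i * (1 + X) ^ (2 * m)) by ring, symmetrization_succ_X_mul, ih]

theorem reflect_eq_sum {n : ℕ} {γ : R[X]} (hγ : γ.natDegree ≤ n) :
    reflect n γ = ∑ i ∈ Finset.range (n + 1), C (γ.coeff i) * X ^ (n - i) := by
  conv_lhs => rw [as_sum_range_C_mul_X_pow' γ (Nat.lt_succ_of_le hγ)]
  have hadd : ∀ s : Finset ℕ, reflect n (∑ i ∈ s, C (γ.coeff i) * X ^ i)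
      = ∑ i ∈ s, reflect n (C (γ.coeff i) * X ^ i) := by
    intro s
    induction s using Finset.induction_on with
    | empty => simp
    | insert a s ha ih => rw [Finset.sum_insert ha, Finset.sum_insert ha, reflect_add, ih]
  rw [hadd]
  refine Finset.sum_congr rfl fun i hi => ?_
  rw [reflect_C_mul_X_pow, revAt_le (Nat.lt_succ_iff.mp (Finset.mem_range.mp hi))]

theorem symmetrization_eq_shiftedReciprocal {n : ℕ} {h γ : R[X]}
    (hγ : IsGammaPolynomial n h γ) :
    symmetrization R n h = 2 * shiftedReciprocal n γ (X + 2) := by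
  conv_lhs => rw [hγ.2]
  rw [shiftedReciprocal, reflect_eq_sum hγ.1, map_sum, Polynomial.sum_comp, Finset.mul_sum]
  refine Finset.sum_congr rfl fun i hi => ?_
  have hi' : i ≤ n := Nat.lt_succ_iff.mp (Finset.mem_range.mp hi)
  have := symmetrization_gamma_term (R := R) i (n - i)
  rw [Nat.add_sub_cancel' hi', show 2 * (n - i) = 2 * n - 2 * i by omega] at this
  rw [mul_assoc, symmetrization_C_mul, this]
  simp
  ring

/-- The coefficients h_{n-j} and h_{n+j} agree and C_{-j} = C_j, so the two halves of the sum
coincide; the middle term contributes h_n C_0 = 2h_n. -/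
theorem symmetrization_of_isReciprocal {n : ℕ} {h : R[X]} (hh : IsReciprocal n h) :
    symmetrization R n h
      = 2 * (C (h.coeff n) + ∑ j ∈ Finset.Icc 1 n, C (h.coeff (n - j)) * Chebyshev.C R j) := by
  have e1 : symmetrization R n h
      = ∑ k ∈ Finset.range (2 * n + 1), C (h.coeff k) * Chebyshev.C R ((k : ℤ) - n) := by
    conv_lhs => rw [as_sum_range_C_mul_X_pow' h (Nat.lt_succ_of_le hh.1)]
    simp only [map_sum, symmetrization_C_mul, symmetrization_X_pow]
  have e2 : ∑ j ∈ Finset.Icc 1 n, C (h.coeff (n - j)) * Chebyshev.C R j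
      = ∑ j ∈ Finset.range n, C (h.coeff (n - (j + 1))) * Chebyshev.C R ((j + 1 : ℕ) : ℤ) := by
    rw [Finset.range_eq_Ico, Finset.sum_Ico_add' (fun j : ℕ =>
      C (h.coeff (n - j)) * Chebyshev.C R (j : ℤ)) 0 n 1]
    rfl
  rw [e1, e2, show 2 * n + 1 = n + (n + 1) by ring, Finset.sum_range_add, Finset.sum_range_succ',
    ← Finset.sum_range_reflect, mul_add, two_mul (∑ j ∈ _, _)]
  have h1 : ∀ j ∈ Finset.range n,
      C (h.coeff (n - 1 - j)) * Chebyshev.C R (((n - 1 - j : ℕ) : ℤ) - n)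
        = C (h.coeff (n - (j + 1))) * Chebyshev.C R ((j + 1 : ℕ) : ℤ) := by
    intro j hj
    have hj' := Finset.mem_range.mp hj
    rw [← Chebyshev.C_neg, show n - (j + 1) = n - 1 - j by omega]
    congr 2
    omega
  have h2 : ∀ j ∈ Finset.range n,
      C (h.coeff (n + (j + 1))) * Chebyshev.C R (((n + (j + 1) : ℕ) : ℤ) - n)
        = C (h.coeff (n - (j + 1))) * Chebyshev.C R ((j + 1 : ℕ) : ℤ) := by
    intro j hj
    have hj' := Finset.mem_range.mp hj
    rw [hh.2 _ (by omega), show 2 * n - (n + (j + 1)) = n - (j + 1) by omega]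
    congr 2
    push_cast; ring
  rw [Finset.sum_congr rfl h1, Finset.sum_congr rfl h2]
  simp only [add_zero, sub_self, Chebyshev.C_zero]
  ring

/-- Two evaluations of the symmetrization of h are compared. The common factor 2 is cancelled rather
than inverted, so the identity also holds over ℤ, as Part 3 requires. -/
theorem shiftedReciprocal_gammaPoly [IsDomain R] [CharZero R] {n : ℕ} {h : R[X]}
    (hh : IsReciprocal n h) :
    shiftedReciprocal n (gammaPoly n h hh) (X + 2)
      = C (h.coeff n) + ∑ j ∈ Finset.Icc 1 n, C (h.coeff (n - j)) * Chebyshev.C R j := by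
  have h2 : (2 : R[X]) ≠ 0 := two_ne_zero
  refine mul_left_cancel₀ h2 ?_
  rw [← symmetrization_eq_shiftedReciprocal (gammaPoly_spec n h hh),
    symmetrization_of_isReciprocal hh]

theorem shiftedReciprocal_comp (n : ℕ) (γ p q : R[X]) :
    (shiftedReciprocal n γ p).comp q = shiftedReciprocal n γ (p.comp q) := by
  rw [shiftedReciprocal, shiftedReciprocal, comp_assoc]

end Gamma

/-! ### Expansions in the Chebyshev basis -/

/-- The polynomial `a_n + 2 a_{n-1} X + ⋯ + 2 a_0 X^n`. -/
def expansionPoly (n : ℕ) (a : ℕ → ℝ) : ℝ[X] :=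
  C (a n) + ∑ j ∈ Finset.Icc 1 n, C (2 * a (n - j)) * X ^ j

theorem coeff_expansionPoly_zero (n : ℕ) (a : ℕ → ℝ) : (expansionPoly n a).coeff 0 = a n := by
  rw [expansionPoly, coeff_add, coeff_C_zero, finsetSum_coeff, Finset.sum_eq_zero, add_zero]
  intro j hj
  have : 0 ≠ j := by have := (Finset.mem_Icc.mp hj).1; omega
  rw [coeff_C_mul_X_pow, if_neg this]

theorem coeff_expansionPoly {n i : ℕ} (a : ℕ → ℝ) (hi : i ≠ 0) (hin : i ≤ n) :
    (expansionPoly n a).coeff i = 2 * a (n - i) := by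
  rw [expansionPoly, coeff_add, coeff_C_of_ne_zero hi, zero_add, finsetSum_coeff,
    Finset.sum_eq_single i]
  · rw [coeff_C_mul_X_pow, if_pos rfl]
  · intro j _ hj
    rw [coeff_C_mul_X_pow, if_neg hj.symm]
  · intro h
    exact absurd (Finset.mem_Icc.mpr ⟨by omega, hin⟩) h

theorem natDegree_expansionPoly_le (n : ℕ) (a : ℕ → ℝ) : (expansionPoly n a).natDegree ≤ n := by
  refine (natDegree_add_le _ _).trans (max_le (by simp) ?_)
  refine natDegree_sum_le_of_forall_le _ _ fun j hj => ?_
  exact (natDegree_C_mul_X_pow_le _ _).trans (Finset.mem_Icc.mp hj).2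

theorem chebTransform_expansionPoly (n : ℕ) (a : ℕ → ℝ) :
    chebTransform (expansionPoly n a)
      = C (a n) + ∑ j ∈ Finset.Icc 1 n, C (2 * a (n - j)) * Chebyshev.T ℝ (j : ℤ) := by
  have e : C (a n) = C (a n) * 1 := (mul_one _).symm
  rw [expansionPoly, e]
  simp only [map_add, map_sum, chebTransform_C_mul, chebTransform_X_pow, chebTransform_one]

theorem chebExpansion_comp_two_mul_X (n : ℕ) (a : ℕ → ℝ) :
    (chebExpansion n a).comp (2 * X) = chebTransform (expansionPoly n a) := by
  have e : (C (1 / 2 : ℝ) * (2 * X) : ℝ[X]) = X := by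
    rw [← mul_assoc, ← C_ofNat, ← C_mul]
    norm_num
  rw [chebTransform_expansionPoly, chebExpansion]
  simp only [add_comp, C_comp, Polynomial.sum_comp, mul_comp, comp_assoc, X_comp, e, comp_X]

theorem chebMatrix_mulVec_coeffVec {n : ℕ} {p : ℝ[X]} (hp : p.natDegree ≤ n) (j : Fin (n + 1)) :
    (chebMatrix n).mulVec (coeffVec n p) j = chebBasis.repr p j := by
  conv_rhs => rw [as_sum_range_C_mul_X_pow' p (Nat.lt_succ_of_le hp)]
  rw [map_sum, Finsupp.finsetSum_apply, ← Fin.sum_univ_eq_sum_range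
    (fun i => (chebBasis.repr (C (p.coeff i) * X ^ i)) (j : ℕ)), Matrix.mulVec, dotProduct]
  refine Finset.sum_congr rfl fun i _ => ?_
  rw [← smul_eq_C_mul, map_smul, Finsupp.smul_apply, smul_eq_mul, mul_comm]
  rfl

theorem natDegree_chebTransform_le {n : ℕ} {p : ℝ[X]} (hp : p.natDegree ≤ n) :
    (chebTransform p).natDegree ≤ n := by
  rw [as_sum_range_C_mul_X_pow' p (Nat.lt_succ_of_le hp), map_sum]
  refine natDegree_sum_le_of_forall_le _ _ fun i hi => ?_
  rw [chebTransform_C_mul, chebTransform_X_pow]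
  refine (natDegree_C_mul_le _ _).trans ?_
  rw [Chebyshev.natDegree_T]
  simpa using Nat.lt_succ_iff.mp (Finset.mem_range.mp hi)

/-- The coefficients are (a_n, 2a_{n-1}, …, 2a_0). Reversal swaps the one entry without a factor 2
with the top one, and the end factors 2 and 1/2 of the tuple correct for this. -/
theorem coeff_expansionPoly_reversedTuple {n i : ℕ} (a : ℕ → ℝ) (hi : i ≤ n) :
    (expansionPoly n (reversedTuple n a)).coeff (n - i) = (expansionPoly n a).coeff i := by
  rcases Nat.eq_zero_or_pos n with rfl | hn
  -- For n = 0 both end factors fall on the same entry and cancel.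
  · obtain rfl : i = 0 := by omega
    simp [coeff_expansionPoly_zero, reversedTuple]
  rcases Nat.eq_zero_or_pos i with rfl | hi0
  · rw [coeff_expansionPoly_zero, coeff_expansionPoly _ (by omega) (by omega), reversedTuple]
    simp [hn.ne]
  · rw [coeff_expansionPoly _ (by omega) hi]
    rcases hi.eq_or_lt with rfl | hlt
    · simp [coeff_expansionPoly_zero, reversedTuple, hn.ne']
    · rw [coeff_expansionPoly _ (by omega) (by omega), reversedTuple, if_neg (by omega),
        if_neg (by omega), Nat.sub_sub_self hi]
      ring

theorem ofCoeffVec_eq {n : ℕ} {p : ℝ[X]} (hp : p.natDegree ≤ n) {w : Fin (n + 1) → ℝ}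
    (hw : ∀ i : Fin (n + 1), w i = p.coeff i) : ofCoeffVec n w = p := by
  conv_rhs => rw [as_sum_range_C_mul_X_pow' p (Nat.lt_succ_of_le hp)]
  rw [ofCoeffVec, ← Fin.sum_univ_eq_sum_range (fun i => C (p.coeff i) * X ^ i)]
  simp only [hw]

theorem ofCoeffVec_rev_chebMatrix_mulVec (n : ℕ) (a : ℕ → ℝ) :
    (ofCoeffVec n fun i => (chebMatrix n).mulVec
      (coeffVec n ((chebExpansion n (reversedTuple n a)).comp (2 * X))) i.rev)
      = expansionPoly n a := by
  refine ofCoeffVec_eq (natDegree_expansionPoly_le n a) fun i => ?_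
  rw [chebExpansion_comp_two_mul_X, chebMatrix_mulVec_coeffVec
    (natDegree_chebTransform_le (natDegree_expansionPoly_le _ _)), chebBasis_repr_chebTransform,
    Fin.val_rev, show n + 1 - (i + 1 : ℕ) = n - i by omega,
    coeff_expansionPoly_reversedTuple a (by omega)]

/-! ### The degree of the `F`-polynomial -/

section Degree

variable {V : Type*} {K : PreAbstractSimplicialComplex V}

theorem FPoly_comp (K : PreAbstractSimplicialComplex V) : (FPoly K).comp (2 * X + 1) = fPoly K := by
  have e : (C (1 / 2 : ℝ) * (X - 1) : ℝ[X]).comp (2 * X + 1) = X := by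
    simp only [mul_comp, C_comp, sub_comp, X_comp, one_comp, add_sub_cancel_right]
    rw [← mul_assoc, ← C_ofNat, ← C_mul]
    norm_num
  rw [FPoly, comp_assoc, e, comp_X]

/-- The coefficients count faces, so the contribution of s cannot cancel. -/
theorem card_le_natDegree_fPoly (hK : K.faces.Finite) {s : Finset V} (hs : s ∈ K.faces) :
    s.card ≤ (fPoly K).natDegree := by
  refine le_natDegree_of_ne_zero (ne_of_gt ?_)
  have hs0 : s.card ≠ 0 := Finset.card_ne_zero.mpr (K.isRelLowerSet_faces hs).1
  rw [fPoly, finsum_mem_eq_finite_toFinset_sum _ hK, coeff_add, finsetSum_coeff, coeff_one,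
    if_neg hs0, zero_add]
  refine Finset.sum_pos' (fun t _ => ?_) ⟨s, hK.mem_toFinset.mpr hs, ?_⟩
  · rw [coeff_X_pow]; split_ifs <;> norm_num
  · rw [coeff_X_pow]; norm_num

theorem card_le_natDegree_FPoly (hK : K.faces.Finite) {s : Finset V} (hs : s ∈ K.faces) :
    s.card ≤ (FPoly K).natDegree := by
  refine (card_le_natDegree_fPoly hK hs).trans ?_
  rw [← FPoly_comp]
  refine natDegree_comp_le.trans ?_
  have : (2 * X + 1 : ℝ[X]).natDegree ≤ 1 := by
    rw [← C_ofNat, ← C_1]; exact natDegree_linear_le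
  simpa using Nat.mul_le_mul_left (FPoly K).natDegree this

theorem skeleton_eq_self {n : ℕ} (h : ∀ s ∈ K.faces, s.card ≤ n + 1) : skeleton n K = K := by
  have : (skeleton n K).faces = K.faces := Set.ext fun s => ⟨fun hs => hs.1, fun hs => ⟨hs, h s hs⟩⟩
  exact SetLike.coe_injective this

end Degree

/-! ### The gamma polynomial of a triangulated skeleton, and the correspondence of F-polynomials -/

theorem tchebyshev_skeleton_gamma {n : ℕ} {h : ℝ[X]} (hh : IsReciprocal n h) {V : Type*}
    {K : PreAbstractSimplicialComplex V} (hK : K.faces.Finite)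
    (hF : FPoly K = expansionPoly n h.coeff) {L : PreAbstractSimplicialComplex (V ⊕ Finset V)}
    (hL : IsTchebyshevTriangulation (skeleton n K) L) :
    FPoly L = shiftedReciprocal n (gammaPoly n h hh) (2 * X + 2) ∧
      fPoly L = shiftedReciprocal n (gammaPoly n h hh) (2 * (2 * X + 1) + 2) := by
  -- F has degree at most n, so faces have at most n vertices and truncation to the n-skeleton
  -- removes nothing.
  have hdeg : ∀ s ∈ K.faces, s.card ≤ n + 1 := fun s hs =>
    ((card_le_natDegree_FPoly hK hs).trans (hF ▸ natDegree_expansionPoly_le _ _)).trans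
      n.le_succ
  rw [skeleton_eq_self hdeg] at hL
  have h1 : FPoly L = shiftedReciprocal n (gammaPoly n h hh) (2 * X + 2) := by
    rw [FPoly_of_isTchebyshevTriangulation hK hL, hF, chebTransform_expansionPoly,
      show (2 * X + 2 : ℝ[X]) = (X + 2 : ℝ[X]).comp (2 * X) by simp, ← shiftedReciprocal_comp,
      shiftedReciprocal_gammaPoly hh]
    simp only [add_comp, C_comp, Polynomial.sum_comp, mul_comp, Chebyshev.C_comp_two_mul_X]
    congr 1
    refine Finset.sum_congr rfl fun j _ => ?_
    rw [C_mul, C_ofNat]; ring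
  refine ⟨h1, ?_⟩
  rw [← FPoly_comp, h1, shiftedReciprocal_comp]
  simp

theorem isTchebyshevFPolynomial_chebTransform_iff (p : ℝ[X]) :
    IsTchebyshevFPolynomial (chebTransform p) ↔ IsFPolynomial p := by
  constructor
  · rintro ⟨V, K, L, hK, hL, h⟩
    rw [FPoly_of_isTchebyshevTriangulation hK hL] at h
    exact ⟨V, K, hK, chebTransform.injective h⟩
  · rintro ⟨V, K, hK, rfl⟩
    obtain ⟨L, hL⟩ := exists_isTchebyshevTriangulation K hK
    exact ⟨V, K, L, hK, hL, FPoly_of_isTchebyshevTriangulation hK hL⟩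

/-! ### Calculus in the Grothendieck ring -/

namespace K0

open SL2Rep

theorem mk_eq_of_equiv {M N : SL2Rep} (e : M ≃ₗ⁅ℂ, sl2⁆ N) : mk M = mk N := by
  have : (Quotient.mk isoSetoid M : IsoClass) = Quotient.mk isoSetoid N := Quotient.sound ⟨e⟩
  rw [mk, mk, gen, gen, this]

theorem mk_eq_add {M' M M'' : SL2Rep} (h : IsShortExact M' M M'') : mk M = mk M' + mk M'' := by
  have : Ideal.Quotient.mk relations (gen M - gen M' - gen M'') = 0 :=
    Ideal.Quotient.eq_zero_iff_mem.mpr (Ideal.subset_span ⟨M', M, M'', h, rfl⟩)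
  rw [map_sub, map_sub] at this
  rw [mk, mk, mk]
  linear_combination this

theorem mk_tensor (M N : SL2Rep) : mk (tensor M N) = mk M * mk N := by
  rw [mk, mk, mk, ← map_mul]
  exact congrArg (Ideal.Quotient.mk relations) (FreeAbelianGroup.of_mul
    (α := IsoClass) (Quotient.mk isoSetoid M) (Quotient.mk isoSetoid N))

theorem mk_trivial : mk trivial = 1 := by
  rw [mk, ← map_one (Ideal.Quotient.mk relations), FreeAbelianGroup.one_def]
  rfl

/-- If M = 0, then 0 → M → M → M → 0 is exact, whence [M] = 2[M]. -/
theorem mk_eq_zero (M : SL2Rep) [Subsingleton M] : mk M = 0 := by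
  have h : IsShortExact M M M :=
    ⟨LieModuleHom.id, 0, fun _ _ h => h, fun y => ⟨fun _ => ⟨y, rfl⟩, fun _ => Subsingleton.elim _ _⟩,
      fun y => ⟨0, Subsingleton.elim _ _⟩⟩
  simpa using mk_eq_add h

/-- Reindexing of a direct sum. -/
def directSumReindex {ι κ : Type} [Fintype ι] [Fintype κ] (e : ι ≃ κ) (M : κ → SL2Rep) :
    directSum (fun i => M (e i)) ≃ₗ⁅ℂ, sl2⁆ directSum M := by
  classical
  let E : (⨁ i, M (e i)) ≃ₗ[ℂ] ⨁ k, M k :=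
    (DirectSum.linearEquivFunOnFintype ℂ ι fun i => M (e i)).trans
      ((LinearEquiv.piCongrLeft ℂ (fun k => (M k : Type)) e).trans
        (DirectSum.linearEquivFunOnFintype ℂ κ fun k => M k).symm)
  have hE : ∀ (m : ⨁ i, M (e i)) (i : ι), (E m) (e i) = m i := by
    intro m i
    exact Equiv.piCongrLeft_apply_apply (fun k => (M k : Type)) e (fun i => m i) i
  refine mkEquiv (M := ⨁ i, M (e i)) (N := ⨁ k, M k) E fun x m => ?_
  refine DFinsupp.ext fun k => ?_
  obtain ⟨i, rfl⟩ := e.surjective k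
  exact (hE _ i).trans (congrArg (fun y => ⁅x, y⁆) (hE m i).symm)

/-- Splitting off the summand at `none` is the inductive step for additivity over finite direct
sums. -/
theorem isShortExact_directSum_option {ι : Type} [Fintype ι] (M : Option ι → SL2Rep) :
    IsShortExact (directSum fun i => M (some i)) (directSum M) (M none) := by
  classical
  let F : (⨁ i, M (some i)) →ₗ[ℂ] ⨁ k, M k :=
    DirectSum.toModule ℂ ι _ fun i => DirectSum.lof ℂ (Option ι) (fun k => M k) (some i)
  have hF : ∀ (m : ⨁ i, M (some i)) (i : ι), F m (some i) = m i := by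
    intro m i
    induction m using DirectSum.induction_on with
    | zero => simp
    | of j y =>
      change F (DirectSum.lof ℂ ι (fun i => M (some i)) j y) (some i)
        = DirectSum.lof ℂ ι (fun i => M (some i)) j y i
      rw [DirectSum.toModule_lof]
      by_cases h : j = i
      · subst h; simp only [DirectSum.lof_apply]
      · rw [DirectSum.lof_eq_of, DirectSum.lof_eq_of, DirectSum.of_eq_of_ne _ _ _ (Ne.symm h),
          DirectSum.of_eq_of_ne _ _ _ (fun h' => h (Option.some.inj h').symm)]
    | add a b ha hb => rw [map_add, DirectSum.add_apply, DirectSum.add_apply, ha, hb]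
  have hF0 : ∀ m : ⨁ i, M (some i), F m none = 0 := by
    intro m
    induction m using DirectSum.induction_on with
    | zero => simp
    | of j y =>
      change F (DirectSum.lof ℂ ι (fun i => M (some i)) j y) none = 0
      rw [DirectSum.toModule_lof, DirectSum.lof_eq_of,
        DirectSum.of_eq_of_ne _ _ _ (by simp)]
    | add a b ha hb => rw [map_add, DirectSum.add_apply, ha, hb, add_zero]
  refine ⟨{ F with map_lie' := fun {x m} => ?_ },
    DirectSum.lieModuleComponent ℂ (Option ι) sl2 (fun k => M k) none, ?_, ?_, ?_⟩
  · change F ⁅x, m⁆ = ⁅x, F m⁆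
    refine DFinsupp.ext fun k => ?_
    rcases k with _ | i
    · exact (hF0 _).trans ((lie_zero x).symm.trans (congrArg (fun y => ⁅x, y⁆) (hF0 m).symm))
    · exact (hF _ i).trans (congrArg (fun y => ⁅x, y⁆) (hF m i).symm)
  · intro m m' h
    refine DFinsupp.ext fun i => ?_
    rw [← hF m i, ← hF m' i]
    exact congrArg (fun y : ⨁ k, M k => y (some i)) h
  · intro y
    constructor
    · intro h
      let z : ⨁ k, M k := y
      have hz := LinearEquiv.apply_symm_apply
        (DirectSum.linearEquivFunOnFintype ℂ ι fun i => (M (some i) : Type)) fun i => z (some i)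
      refine ⟨(DirectSum.linearEquivFunOnFintype ℂ ι fun i => (M (some i) : Type)).symm
        fun i => z (some i), ?_⟩
      refine DFinsupp.ext fun k => ?_
      rcases k with _ | i
      · exact (hF0 _).trans h.symm
      · exact (hF _ i).trans (congrFun hz i)
    · rintro ⟨m, rfl⟩
      exact hF0 m
  · intro y
    exact ⟨DirectSum.lof ℂ (Option ι) (fun k => M k) none y, 
      DirectSum.lof_apply (M := fun k => (M k : Type)) ℂ none y⟩

theorem mk_directSum {ι : Type} [hι : Fintype ι] (M : ι → SL2Rep) :
    mk (directSum M) = ∑ i, mk (M i) := by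
  refine Fintype.induction_empty_option
    (P := fun ι _ => ∀ M : ι → SL2Rep, mk (directSum M) = ∑ i, mk (M i)) ?_ ?_ ?_ ι M
  · intro α β _ e ih M
    let _ := Fintype.ofEquiv β e.symm
    rw [← mk_eq_of_equiv (directSumReindex e M), ih]
    exact Equiv.sum_comp e fun k => mk (M k)
  · intro M
    have : Subsingleton (directSum M) :=
      ⟨fun a b => DFinsupp.ext fun i : PEmpty => i.elim⟩
    rw [mk_eq_zero]
    simp
  · intro α _ ih M
    rw [mk_eq_add (isShortExact_directSum_option M), ih, Fintype.sum_option, add_comm]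

theorem mk_sumOfSymPow (n : ℕ) (m : ℕ → ℕ) :
    mk (sumOfSymPow n m) = ∑ j ∈ Finset.Icc 1 n, m j • mk (symPow (j - 1)) := by
  rw [sumOfSymPow, mk_directSum, Fintype.sum_sigma]
  simp only [Finset.sum_const, Finset.card_univ, Fintype.card_fin]
  rw [Fin.sum_univ_eq_sum_range (fun j => m (j + 1) • mk (symPow j)), Finset.range_eq_Ico]
  exact Finset.sum_Ico_add' (fun j => m j • mk (symPow (j - 1))) 0 n 1

end K0

namespace SL2Rep

attribute [local instance 100] LieRing.ofAssociativeRing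

/-! ### Binary forms -/

/-- The exponent of the monomial `x_0^i x_1^{k-i}`. -/
def formExponent (k i : ℕ) : Fin 2 →₀ ℕ := Finsupp.single 0 i + Finsupp.single 1 (k - i)

theorem eq_formExponent {k : ℕ} {d : Fin 2 →₀ ℕ} (hd : d.degree = k) :
    d = formExponent k (d 0) ∧ d 0 ≤ k := by
  rw [Finsupp.degree_eq_sum, Fin.sum_univ_two] at hd
  refine ⟨?_, by omega⟩
  ext i
  fin_cases i
  · simp [formExponent]
  · simp [formExponent]; omega

theorem monomial_formExponent (k i : ℕ) :
    MvPolynomial.monomial (formExponent k i) (1 : ℂ)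
      = MvPolynomial.X 0 ^ i * MvPolynomial.X 1 ^ (k - i) := by
  rw [formExponent, MvPolynomial.X_pow_eq_monomial, MvPolynomial.X_pow_eq_monomial,
    MvPolynomial.monomial_mul, one_mul]

theorem form_eq_sum {k : ℕ} {p : MvPolynomial (Fin 2) ℂ} (hp : p.IsHomogeneous k) :
    p = ∑ i ∈ Finset.range (k + 1), p.coeff (formExponent k i) •
      (MvPolynomial.X 0 ^ i * MvPolynomial.X 1 ^ (k - i)) := by
  have hinj : ∀ i j, formExponent k i = formExponent k j → i = j := fun i j h => by
    simpa [formExponent] using DFunLike.congr_fun h 0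
  simp only [← monomial_formExponent]
  ext d
  rw [MvPolynomial.coeff_sum]
  simp only [MvPolynomial.coeff_smul, MvPolynomial.coeff_monomial, smul_eq_mul]
  by_cases hd : d.degree = k
  · obtain ⟨h1, h2⟩ := eq_formExponent hd
    rw [Finset.sum_eq_single (d 0)]
    · rw [if_pos h1.symm, ← h1, mul_one]
    · intro j _ hj
      rw [if_neg, mul_zero]
      intro h
      rw [h1] at h
      exact hj (hinj _ _ h)
    · intro h
      exact absurd (Finset.mem_range.mpr (by omega)) h
  · rw [hp.coeff_eq_zero hd, Finset.sum_eq_zero]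
    intro j hj
    rw [if_neg, mul_zero]
    rintro rfl
    refine hd ?_
    have := Finset.mem_range.mp hj
    simp [formExponent, Finsupp.degree_eq_sum]
    omega

theorem isHomogeneous_form {k i : ℕ} (hi : i ≤ k) :
    (MvPolynomial.X 0 ^ i * MvPolynomial.X 1 ^ (k - i) : MvPolynomial (Fin 2) ℂ).IsHomogeneous
      k := by
  have := (MvPolynomial.isHomogeneous_X_pow (R := ℂ) (0 : Fin 2) i).mul
    (MvPolynomial.isHomogeneous_X_pow (R := ℂ) (1 : Fin 2) (k - i))
  rwa [Nat.add_sub_cancel' hi] at this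

theorem homogeneousSubmodule_eq_span (k : ℕ) :
    MvPolynomial.homogeneousSubmodule (Fin 2) ℂ k = Submodule.span ℂ (Set.range
      fun i : Fin (k + 1) => (MvPolynomial.X 0 ^ (i : ℕ) * MvPolynomial.X 1 ^ (k - i) :
        MvPolynomial (Fin 2) ℂ)) := by
  refine le_antisymm (fun p hp => ?_) (Submodule.span_le.mpr ?_)
  · rw [form_eq_sum hp]
    exact Submodule.sum_mem _ fun i hi => Submodule.smul_mem _ _
      (Submodule.subset_span ⟨⟨i, Finset.mem_range.mp hi⟩, rfl⟩)
  · rintro _ ⟨i, rfl⟩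
    exact isHomogeneous_form (Nat.lt_succ_iff.mp i.2)

theorem finrank_homogeneousSubmodule (k : ℕ) :
    Module.finrank ℂ (MvPolynomial.homogeneousSubmodule (Fin 2) ℂ k) = k + 1 := by
  have hli : LinearIndependent ℂ fun i : Fin (k + 1) =>
      (MvPolynomial.X 0 ^ (i : ℕ) * MvPolynomial.X 1 ^ (k - i) : MvPolynomial (Fin 2) ℂ) := by
    have := (MvPolynomial.basisMonomials (Fin 2) ℂ).linearIndependent.comp
      (fun i : Fin (k + 1) => formExponent k i) fun i j h => by
        simpa [formExponent, Fin.ext_iff] using DFunLike.congr_fun h 0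
    have heq : (fun i : Fin (k + 1) => (MvPolynomial.X 0 ^ (i : ℕ) * MvPolynomial.X 1 ^ (k - i) :
        MvPolynomial (Fin 2) ℂ))
        = MvPolynomial.basisMonomials (Fin 2) ℂ ∘ fun i : Fin (k + 1) => formExponent k i := by
      funext i
      rw [← monomial_formExponent]
      simp
    rw [heq]
    exact this
  rw [homogeneousSubmodule_eq_span, finrank_span_eq_card hli, Fintype.card_fin]

/-- Needed in the exactness proof, where a form is divided by a variable and the quotient must again
lie in a symmetric power. -/
theorem isHomogeneous_of_X_mul {k : ℕ} {i : Fin 2} {p : MvPolynomial (Fin 2) ℂ}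
    (h : (MvPolynomial.X i * p).IsHomogeneous (k + 1)) : p.IsHomogeneous k := by
  intro d hd
  have := h (d := Finsupp.single i 1 + d) (by rwa [MvPolynomial.coeff_X_mul])
  rw [map_add, Finsupp.weight_single] at this
  simp only [Pi.one_apply, smul_eq_mul, mul_one] at this
  omega

/-! ### Irreducibility of the symmetric powers -/

/-- The binary form underlying an element of `Sym^k V`. -/
def form (k : ℕ) : symPow k →ₗ[ℂ] MvPolynomial (Fin 2) ℂ :=
  (MvPolynomial.homogeneousSubmodule (Fin 2) ℂ k).subtype

theorem form_injective (k : ℕ) : Function.Injective (form k) := Subtype.val_injective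

theorem isHomogeneous_form_apply {k : ℕ} (p : symPow k) : (form k p).IsHomogeneous k :=
  Subtype.property (show MvPolynomial.homogeneousSubmodule (Fin 2) ℂ k from p)

theorem exists_form_eq {k : ℕ} {p : MvPolynomial (Fin 2) ℂ} (hp : p.IsHomogeneous k) :
    ∃ q, form k q = p :=
  ⟨(⟨p, hp⟩ : MvPolynomial.homogeneousSubmodule (Fin 2) ℂ k), rfl⟩

theorem form_lie {k : ℕ} (A : sl2) (p : symPow k) :
    form k ⁅A, p⁆ = symDerivation A.1 (form k p) := rfl

theorem finrank_symPow (k : ℕ) : Module.finrank ℂ (symPow k) = k + 1 :=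
  finrank_homogeneousSubmodule k

theorem symDerivation_X (A : Matrix (Fin 2) (Fin 2) ℂ) (j : Fin 2) :
    symDerivation A (MvPolynomial.X j)
      = MvPolynomial.C (A 0 j) * MvPolynomial.X 0 + MvPolynomial.C (A 1 j) * MvPolynomial.X 1 := by
  rw [symDerivation, MvPolynomial.mkDerivation_X, Fin.sum_univ_two]

/-- Serves both the raising and the lowering operator, with the roles of the variables exchanged.
For m > j the falling factorial vanishes, so the truncated exponent j - m does no harm. -/
theorem derivation_pow_mul_pow {D : Derivation ℂ (MvPolynomial (Fin 2) ℂ) (MvPolynomial (Fin 2) ℂ)}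
    {x y : MvPolynomial (Fin 2) ℂ} (hx : D x = y) (hy : D y = 0) (i j m : ℕ) :
    D^[m] (x ^ j * y ^ i) = (j.descFactorial m : ℂ) • (x ^ (j - m) * y ^ (i + m)) := by
  induction m with
  | zero => simp
  | succ m ih =>
    rw [Function.iterate_succ_apply', ih, D.map_smul, D.leibniz, D.leibniz_pow, D.leibniz_pow, hx,
      hy, Nat.descFactorial_succ, Nat.sub_sub]
    simp only [smul_eq_mul, nsmul_eq_mul, Nat.cast_mul,
      MvPolynomial.smul_eq_C_mul, map_mul, map_natCast]
    ring

/-- A nonzero submodule contains x_0^k: take a nonzero form in it and raise it until one monomial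
survives. Lowering x_0^k then yields every monomial up to a nonzero scalar. The argument runs on the
image `S` in the polynomial ring. -/
theorem isIrreducible_symPow (k : ℕ) : LieModule.IsIrreducible ℂ sl2 (symPow k) := by
  have : Nontrivial (symPow k) := Module.nontrivial_of_finrank_pos (R := ℂ) (by
    rw [finrank_symPow]; omega)
  refine LieModule.IsIrreducible.mk fun N hN => ?_
  set S : Submodule ℂ (MvPolynomial (Fin 2) ℂ) := N.toSubmodule.map (form k) with hS
  have hlie : ∀ (A : sl2) (m : ℕ), ∀ p ∈ S, (symDerivation A.1)^[m] p ∈ S := by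
    intro A m
    induction m with
    | zero => exact fun p hp => hp
    | succ m ih =>
      rintro _ ⟨p, hp, rfl⟩
      rw [Function.iterate_succ_apply, ← form_lie]
      exact ih _ ⟨_, N.lie_mem hp, rfl⟩
  let e : sl2 := LieAlgebra.SpecialLinear.single 0 1 (by decide) (1 : ℂ)
  let f : sl2 := LieAlgebra.SpecialLinear.single 1 0 (by decide) (1 : ℂ)
  have he : e.1 = Matrix.single 0 1 1 := rfl
  have hf : f.1 = Matrix.single 1 0 1 := rfl
  have he1 : symDerivation e.1 (MvPolynomial.X 1) = MvPolynomial.X 0 := by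
    simp [symDerivation_X, he]
  have he0 : symDerivation e.1 (MvPolynomial.X 0) = 0 := by
    simp [symDerivation_X, he]
  have hf0 : symDerivation f.1 (MvPolynomial.X 0) = MvPolynomial.X 1 := by
    simp [symDerivation_X, hf]
  have hf1 : symDerivation f.1 (MvPolynomial.X 1) = 0 := by
    simp [symDerivation_X, hf]
  have htop : (MvPolynomial.X 0 ^ k : MvPolynomial (Fin 2) ℂ) ∈ S := by
    obtain ⟨q, hq, hq0⟩ : ∃ q ∈ N, q ≠ 0 := by
      by_contra! h
      exact hN ((LieSubmodule.eq_bot_iff N).mpr h)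
    set p := form k q with hp
    have hsum := form_eq_sum (isHomogeneous_form_apply q)
    rw [← hp] at hsum
    have hex : ∃ i, i ≤ k ∧ p.coeff (formExponent k i) ≠ 0 := by
      by_contra! h
      refine hq0 (form_injective k ?_)
      rw [map_zero, ← hp, hsum]
      refine Finset.sum_eq_zero fun i hi => ?_
      rw [h i (Nat.lt_succ_iff.mp (Finset.mem_range.mp hi)), zero_smul]
    classical
    -- The least power of x_0 occurring is the highest power of x_1: raising k - i times kills all
    -- terms with larger exponent of x_0 and sends this one to (k - i)! x_0^k.
    set i := Nat.find hex with hi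
    obtain ⟨hik, hci⟩ := Nat.find_spec hex
    have hpS : (symDerivation e.1)^[k - i] p ∈ S := hlie e _ p ⟨q, hq, rfl⟩
    have hcomp : (symDerivation e.1)^[k - i] p
        = (p.coeff (formExponent k i) * ((k - i).factorial : ℂ)) • MvPolynomial.X 0 ^ k := by
      have hlin : ∀ r, (symDerivation e.1)^[k - i] r
          = ((symDerivation e.1).toLinearMap ^ (k - i)) r := fun r =>
        (Module.End.pow_apply _ _ _).symm
      conv_lhs => rw [hsum]
      rw [hlin, map_sum, Finset.sum_eq_single i]
      · rw [map_smul, ← hlin, mul_comm (MvPolynomial.X 0 ^ i), derivation_pow_mul_pow he1 he0,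
          Nat.descFactorial_self, Nat.sub_self, pow_zero, one_mul, smul_smul,
          Nat.add_sub_cancel' hik]
      · intro j hj hji
        rcases lt_or_gt_of_ne hji with h | h
        · have := Nat.find_min hex h
          push Not at this
          rw [this (by omega), zero_smul, map_zero]
        · have hjk : j ≤ k := Nat.lt_succ_iff.mp (Finset.mem_range.mp hj)
          rw [map_smul, ← hlin, mul_comm (MvPolynomial.X 0 ^ j), derivation_pow_mul_pow he1 he0,
            Nat.descFactorial_of_lt (by omega), Nat.cast_zero, zero_smul, smul_zero]
      · intro h
        exact absurd (Finset.mem_range.mpr (by omega)) h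
    rw [hcomp] at hpS
    exact (Submodule.smul_mem_iff S (mul_ne_zero hci
      (Nat.cast_ne_zero.mpr (Nat.factorial_ne_zero _)))).mp hpS
  have hall : ∀ i ≤ k, (MvPolynomial.X 0 ^ i * MvPolynomial.X 1 ^ (k - i) :
      MvPolynomial (Fin 2) ℂ) ∈ S := by
    intro i hi
    have h1 := hlie f (k - i) _ htop
    have h2 := derivation_pow_mul_pow hf0 hf1 0 k (k - i)
    rw [pow_zero, mul_one, Nat.sub_sub_self hi, zero_add] at h2
    rw [h2] at h1
    refine (Submodule.smul_mem_iff S ?_).mp h1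
    exact Nat.cast_ne_zero.mpr fun h => by
      have := Nat.descFactorial_eq_zero_iff_lt.mp h
      omega
  rw [eq_top_iff]
  intro q _
  have hq : form k q ∈ S := by
    rw [form_eq_sum (isHomogeneous_form_apply q)]
    exact Submodule.sum_mem _ fun i hi => Submodule.smul_mem _ _
      (hall i (Nat.lt_succ_iff.mp (Finset.mem_range.mp hi)))
  obtain ⟨q', hq', h⟩ := hq
  rwa [← form_injective k h]

/-! ### The Clebsch–Gordan sequence `0 → Sym^k V → V ⊗ Sym^{k+1} V → Sym^{k+2} V → 0` -/

/-- The standard basis of `V`. -/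
def stdVec (i : Fin 2) : std := (Pi.single i 1 : Fin 2 → ℂ)

/-- The coordinates on `V`. -/
def stdCoord (i : Fin 2) : std →ₗ[ℂ] ℂ := (LinearMap.proj i : (Fin 2 → ℂ) →ₗ[ℂ] ℂ)

theorem stdCoord_stdVec (i j : Fin 2) : stdCoord i (stdVec j) = if i = j then 1 else 0 :=
  Pi.single_apply j (1 : ℂ) i

theorem std_ext {v w : std} (h : ∀ i, stdCoord i v = stdCoord i w) : v = w := funext h

theorem stdCoord_lie (A : sl2) (v : std) (i : Fin 2) :
    stdCoord i ⁅A, v⁆ = A.1 i 0 * stdCoord 0 v + A.1 i 1 * stdCoord 1 v := by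
  let v' : Fin 2 → ℂ := v
  have h : stdCoord i ⁅A, v⁆ = A.1.mulVec v' i := rfl
  have h' : A.1.mulVec v' i = A.1 i 0 * v' 0 + A.1 i 1 * v' 1 := by
    simp [Matrix.mulVec, dotProduct, Fin.sum_univ_two]
  exact h.trans h'

theorem std_eq (v : std) : v = stdCoord 0 v • stdVec 0 + stdCoord 1 v • stdVec 1 := by
  refine std_ext fun i => ?_
  rw [map_add, map_smul, map_smul]
  simp only [stdCoord_stdVec]
  fin_cases i <;> simp

theorem lie_stdVec (A : sl2) (j : Fin 2) :
    ⁅A, stdVec j⁆ = A.1 0 j • stdVec 0 + A.1 1 j • stdVec 1 := by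
  rw [std_eq ⁅A, stdVec j⁆]
  simp only [stdCoord_lie, stdCoord_stdVec]
  fin_cases j <;> simp

theorem finrank_std : Module.finrank ℂ std = 2 := by
  have : Module.finrank ℂ (Fin 2 → ℂ) = 2 := by simp
  exact this

/-- The linear form attached to a vector of `V`. -/
def linearForm : std →ₗ[ℂ] MvPolynomial (Fin 2) ℂ :=
  (stdCoord 0).smulRight (MvPolynomial.X 0) + (stdCoord 1).smulRight (MvPolynomial.X 1)

theorem linearForm_apply (v : std) :
    linearForm v = stdCoord 0 v • MvPolynomial.X 0 + stdCoord 1 v • MvPolynomial.X 1 := rfl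

theorem linearForm_stdVec (i : Fin 2) : linearForm (stdVec i) = MvPolynomial.X i := by
  simp only [linearForm_apply, stdCoord_stdVec]
  fin_cases i <;> simp

theorem isHomogeneous_linearForm (v : std) : (linearForm v).IsHomogeneous 1 :=
  ((MvPolynomial.homogeneousSubmodule (Fin 2) ℂ 1).smul_mem _
    (MvPolynomial.isHomogeneous_X ℂ 0)).add
    ((MvPolynomial.homogeneousSubmodule (Fin 2) ℂ 1).smul_mem _
      (MvPolynomial.isHomogeneous_X ℂ 1))

theorem linearForm_lie (A : sl2) (v : std) :
    linearForm ⁅A, v⁆ = symDerivation A.1 (linearForm v) := by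
  rw [linearForm_apply, linearForm_apply, map_add, Derivation.map_smul, Derivation.map_smul,
    symDerivation_X, symDerivation_X, stdCoord_lie, stdCoord_lie]
  simp only [MvPolynomial.smul_eq_C_mul, map_add, map_mul]
  ring

/-- Multiplication `V → Hom(Sym^k V, Sym^{k+1} V)`. -/
def mulLinearForm (k : ℕ) : std →ₗ[ℂ] symPow k →ₗ[ℂ] symPow (k + 1) :=
  LinearMap.mk₂ ℂ
    (fun v p => (⟨linearForm v * form k p, by
      rw [add_comm]
      exact (isHomogeneous_linearForm v).mul (isHomogeneous_form_apply p)⟩ :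
        MvPolynomial.homogeneousSubmodule (Fin 2) ℂ (k + 1)))
    (fun v w p => Subtype.ext (by
      change linearForm (v + w) * _ = linearForm v * _ + linearForm w * _
      rw [map_add, add_mul]))
    (fun c v p => Subtype.ext (by
      change linearForm (c • v) * _ = c • (linearForm v * _)
      rw [map_smul, smul_mul_assoc]))
    (fun v p q => Subtype.ext (by
      change _ * form k (p + q) = _ * form k p + _ * form k q
      rw [map_add, mul_add]))
    (fun c v p => Subtype.ext (by
      change _ * form k (c • p) = c • (_ * form k p)
      rw [map_smul, mul_smul_comm]))

theorem form_mulLinearForm {k : ℕ} (v : std) (p : symPow k) :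
    form (k + 1) (mulLinearForm k v p) = linearForm v * form k p := rfl

theorem lie_mulLinearForm {k : ℕ} (A : sl2) (v : std) (p : symPow k) :
    ⁅A, mulLinearForm k v p⁆ = mulLinearForm k ⁅A, v⁆ p + mulLinearForm k v ⁅A, p⁆ := by
  refine form_injective _ ?_
  rw [form_lie, map_add, form_mulLinearForm, form_mulLinearForm, form_mulLinearForm,
    Derivation.leibniz, linearForm_lie, form_lie]
  simp only [smul_eq_mul]
  ring

/-- The multiplication map `V ⊗ Sym^k V → Sym^{k+1} V`. -/
def mulHom (k : ℕ) : std ⊗[ℂ] symPow k →ₗ⁅ℂ, sl2⁆ symPow (k + 1) :=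
  { TensorProduct.lift (mulLinearForm k) with
    map_lie' := fun {A t} => by
      change TensorProduct.lift (mulLinearForm k) _ = ⁅A, TensorProduct.lift (mulLinearForm k) _⁆
      induction t using TensorProduct.induction_on with
      | zero => simp
      | tmul v p =>
        rw [TensorProduct.LieModule.lie_tmul_right, map_add, TensorProduct.lift.tmul,
          TensorProduct.lift.tmul, TensorProduct.lift.tmul, lie_mulLinearForm]
      | add s t hs ht => rw [lie_add, map_add, map_add, lie_add, hs, ht] }

theorem mulHom_tmul {k : ℕ} (v : std) (p : symPow k) :
    mulHom k (v ⊗ₜ[ℂ] p) = mulLinearForm k v p := rfl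

/-- Tracelessness makes x_0 ⊗ x_1 - x_1 ⊗ x_0 invariant, which the equivariance of `koszulHom` uses.
-/
theorem trace_eq_zero (A : sl2) : A.1 1 1 = -A.1 0 0 := by
  have h : A.1.trace = 0 := A.2
  rw [Matrix.trace_fin_two] at h
  linear_combination h

/-- The equivariant map `p ↦ x_0 ⊗ x_1 p - x_1 ⊗ x_0 p`. -/
def koszulHom (k : ℕ) : symPow k →ₗ⁅ℂ, sl2⁆ std ⊗[ℂ] symPow (k + 1) :=
  { (TensorProduct.mk ℂ std (symPow (k + 1)) (stdVec 0)).comp (mulLinearForm k (stdVec 1)) -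
      (TensorProduct.mk ℂ std (symPow (k + 1)) (stdVec 1)).comp (mulLinearForm k (stdVec 0)) with
    map_lie' := fun {A p} => by
      change stdVec 0 ⊗ₜ[ℂ] mulLinearForm k (stdVec 1) ⁅A, p⁆
          - stdVec 1 ⊗ₜ[ℂ] mulLinearForm k (stdVec 0) ⁅A, p⁆
        = ⁅A, stdVec 0 ⊗ₜ[ℂ] mulLinearForm k (stdVec 1) p
          - stdVec 1 ⊗ₜ[ℂ] mulLinearForm k (stdVec 0) p⁆
      rw [lie_sub, TensorProduct.LieModule.lie_tmul_right, TensorProduct.LieModule.lie_tmul_right,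
        lie_mulLinearForm, lie_mulLinearForm, lie_stdVec, lie_stdVec, trace_eq_zero]
      simp only [map_add, map_smul, LinearMap.add_apply, LinearMap.smul_apply,
        TensorProduct.add_tmul, TensorProduct.tmul_add, TensorProduct.tmul_smul,
        ← TensorProduct.smul_tmul']
      module }

theorem koszulHom_apply {k : ℕ} (p : symPow k) :
    koszulHom k p = stdVec 0 ⊗ₜ[ℂ] mulLinearForm k (stdVec 1) p
      - stdVec 1 ⊗ₜ[ℂ] mulLinearForm k (stdVec 0) p := rfl

theorem exists_tensor_std_eq {M : SL2Rep} (t : std ⊗[ℂ] M) :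
    ∃ a b : M, t = stdVec 0 ⊗ₜ[ℂ] a + stdVec 1 ⊗ₜ[ℂ] b := by
  induction t using TensorProduct.induction_on with
  | zero => exact ⟨0, 0, by simp⟩
  | tmul v m =>
    refine ⟨stdCoord 0 v • m, stdCoord 1 v • m, ?_⟩
    conv_lhs => rw [std_eq v]
    rw [TensorProduct.add_tmul, TensorProduct.smul_tmul, TensorProduct.smul_tmul]
  | add s t hs ht =>
    obtain ⟨a, b, rfl⟩ := hs
    obtain ⟨c, d, rfl⟩ := ht
    refine ⟨a + c, b + d, ?_⟩
    rw [TensorProduct.tmul_add, TensorProduct.tmul_add]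
    abel

theorem mulLinearForm_stdVec_injective (k : ℕ) (i : Fin 2) :
    Function.Injective (mulLinearForm k (stdVec i)) := by
  intro p q h
  refine form_injective k ?_
  have := congrArg (form (k + 1)) h
  rw [form_mulLinearForm, form_mulLinearForm, linearForm_stdVec] at this
  exact mul_left_cancel₀ (MvPolynomial.X_ne_zero i) this

theorem koszulHom_injective (k : ℕ) : Function.Injective (koszulHom k) := by
  intro p q h
  -- Contracting with the coordinate of x_0 recovers x_1 p from the image of p.
  let c : std ⊗[ℂ] symPow (k + 1) →ₗ[ℂ] symPow (k + 1) :=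
    TensorProduct.lift ((LinearMap.lsmul ℂ (symPow (k + 1))).comp (stdCoord 0))
  have hc : ∀ p, c (koszulHom k p) = mulLinearForm k (stdVec 1) p := by
    intro p
    rw [koszulHom_apply, map_sub, TensorProduct.lift.tmul, TensorProduct.lift.tmul]
    simp [stdCoord_stdVec]
  refine mulLinearForm_stdVec_injective k 1 ?_
  rw [← hc, ← hc, h]

/-- If x_0 a + x_1 b = 0, then x_1 divides a, so a = x_1 q, and cancelling x_1 gives b = -x_0 q. -/
theorem exact_koszulHom_mulHom (k : ℕ) :
    Function.Exact (koszulHom k) (mulHom (k + 1)) := by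
  intro t
  constructor
  · intro h
    obtain ⟨a, b, rfl⟩ := exists_tensor_std_eq (M := symPow (k + 1)) t
    have h' := congrArg (form (k + 2)) h
    rw [map_add, map_add, mulHom_tmul, mulHom_tmul, form_mulLinearForm, form_mulLinearForm,
      linearForm_stdVec, linearForm_stdVec, map_zero] at h'
    have hdvd : (MvPolynomial.X 1 : MvPolynomial (Fin 2) ℂ) ∣ form (k + 1) a := by
      have : (MvPolynomial.X 1 : MvPolynomial (Fin 2) ℂ) ∣ MvPolynomial.X 0 * form (k + 1) a :=
        ⟨-form (k + 1) b, by linear_combination h'⟩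
      rcases MvPolynomial.X_dvd_mul_iff.mp this with h0 | h0
      · exact absurd (MvPolynomial.X_dvd_X.mp h0) (by decide)
      · exact h0
    obtain ⟨p, hp⟩ := hdvd
    obtain ⟨q, rfl⟩ := exists_form_eq (isHomogeneous_of_X_mul
      (hp ▸ isHomogeneous_form_apply a))
    have ha : a = mulLinearForm k (stdVec 1) q := form_injective _ (by
      rw [form_mulLinearForm, linearForm_stdVec, hp])
    have hb : b = -mulLinearForm k (stdVec 0) q := form_injective _ (by
      rw [map_neg, form_mulLinearForm, linearForm_stdVec]
      refine mul_left_cancel₀ (MvPolynomial.X_ne_zero (R := ℂ) (1 : Fin 2)) ?_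
      rw [hp] at h'
      linear_combination h')
    refine ⟨q, ?_⟩
    rw [koszulHom_apply, ha, hb, TensorProduct.tmul_neg, sub_eq_add_neg]
  · rintro ⟨p, rfl⟩
    refine form_injective _ ?_
    rw [koszulHom_apply, map_sub, map_sub, mulHom_tmul, mulHom_tmul, form_mulLinearForm,
      form_mulLinearForm, form_mulLinearForm, form_mulLinearForm, map_zero, linearForm_stdVec,
      linearForm_stdVec]
    ring

/-- Each monomial of positive degree is a variable times a monomial: x_0 is split off when it
occurs, x_1 otherwise. -/
theorem mulHom_surjective (k : ℕ) : Function.Surjective (mulHom k) := by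
  intro q
  have hrange : ∀ i ≤ k + 1, ∃ t, form (k + 1) (mulHom k t)
      = MvPolynomial.X 0 ^ i * MvPolynomial.X 1 ^ (k + 1 - i) := by
    intro i hi
    rcases Nat.eq_zero_or_pos i with rfl | hi0
    · obtain ⟨p, hp⟩ := exists_form_eq (isHomogeneous_form (Nat.zero_le k))
      refine ⟨stdVec 1 ⊗ₜ[ℂ] p, ?_⟩
      rw [mulHom_tmul, form_mulLinearForm, linearForm_stdVec, hp]
      simp [pow_succ']
    · obtain ⟨p, hp⟩ := exists_form_eq (isHomogeneous_form (show i - 1 ≤ k by omega))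
      refine ⟨stdVec 0 ⊗ₜ[ℂ] p, ?_⟩
      rw [mulHom_tmul, form_mulLinearForm, linearForm_stdVec, hp,
        show k - (i - 1) = k + 1 - i by omega, ← mul_assoc, ← pow_succ', Nat.sub_add_cancel hi0]
  let S := LinearMap.range ((form (k + 1)).comp (mulHom k : std ⊗[ℂ] symPow k →ₗ[ℂ] symPow (k + 1)))
  have hq : form (k + 1) q ∈ S := by
    rw [form_eq_sum (isHomogeneous_form_apply q)]
    exact Submodule.sum_mem _ fun i hi => Submodule.smul_mem _ _
      (hrange i (Nat.lt_succ_iff.mp (Finset.mem_range.mp hi)))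
  obtain ⟨t, ht⟩ := hq
  exact ⟨t, form_injective _ ht⟩

theorem isShortExact_clebschGordan (k : ℕ) :
    IsShortExact (symPow k) (tensor std (symPow (k + 1))) (symPow (k + 2)) :=
  ⟨koszulHom k, mulHom (k + 1), koszulHom_injective k, exact_koszulHom_mulHom k,
    mulHom_surjective (k + 1)⟩

theorem nonempty_trivial_equiv_symPow_zero : Nonempty (trivial ≃ₗ⁅ℂ, sl2⁆ symPow 0) := by
  obtain ⟨p, hp⟩ := exists_form_eq (MvPolynomial.isHomogeneous_one (Fin 2) ℂ)
  let L : trivial →ₗ[ℂ] symPow 0 := (LinearMap.toSpanSingleton ℂ (symPow 0) p : ℂ →ₗ[ℂ] symPow 0)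
  have hp0 : p ≠ 0 := by
    rintro rfl
    exact one_ne_zero (hp.symm.trans (map_zero _))
  have hinj : Function.Injective L := smul_left_injective ℂ hp0
  have hfin : Module.finrank ℂ trivial = Module.finrank ℂ (symPow 0) :=
    (Module.finrank_self ℂ).trans (finrank_symPow 0).symm
  refine ⟨mkEquiv (LinearEquiv.ofInjectiveOfFinrankEq L hinj hfin) fun x c => ?_⟩
  change L ⁅x, c⁆ = ⁅x, (show ℂ from c) • p⁆
  have hxp : ⁅x, p⁆ = 0 := form_injective 0 (by
    rw [form_lie, hp, Derivation.map_one_eq_zero, map_zero])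
  rw [lie_trivial, map_zero, lie_smul, hxp, smul_zero]

theorem nonempty_std_equiv_symPow_one : Nonempty (std ≃ₗ⁅ℂ, sl2⁆ symPow 1) := by
  let L : std →ₗ[ℂ] symPow 1 :=
    linearForm.codRestrict (MvPolynomial.homogeneousSubmodule (Fin 2) ℂ 1) isHomogeneous_linearForm
  have hL : ∀ v, form 1 (L v) = linearForm v := fun _ => rfl
  have hinj : Function.Injective L := by
    intro v w h
    have h' : linearForm v = linearForm w := by rw [← hL, ← hL, h]
    refine std_ext fun i => ?_
    have hi := congrArg (MvPolynomial.coeff (Finsupp.single i 1)) h'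
    fin_cases i <;>
      simpa [linearForm_apply, MvPolynomial.coeff_X, Finsupp.single_left_inj] using hi
  have hfin : Module.finrank ℂ std = Module.finrank ℂ (symPow 1) :=
    finrank_std.trans (finrank_symPow 1).symm
  refine ⟨mkEquiv (LinearEquiv.ofInjectiveOfFinrankEq L hinj hfin) fun x v => ?_⟩
  refine form_injective 1 ?_
  change form 1 (L ⁅x, v⁆) = form 1 ⁅x, L v⁆
  rw [hL, form_lie, hL, linearForm_lie]

end SL2Rep

/-! ### Chebyshev polynomials of the class of the standard representation -/

/-- In x = t + 1/t this is d(t^n + t^{-n})/dx = n(t^n - t^{-n})/(t - t^{-1}). The induction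
differentiates the recurrence of the C_n and rewrites the extra term as C_{n+1} = 2S_{n+1} - X S_n.
-/
theorem derivative_chebyshev_C (R : Type*) [CommRing R] : ∀ n : ℕ,
    derivative (Chebyshev.C R n) = n * Chebyshev.S R ((n : ℤ) - 1)
  | 0 => by simp
  | 1 => by simp
  | n + 2 => by
    have h1 := derivative_chebyshev_C R (n + 1)
    have h0 := derivative_chebyshev_C R n
    have hC := Chebyshev.C_eq_S_sub_X_mul_S R (n + 1)
    have hS := Chebyshev.S_add_one R n
    push_cast at h1 ⊢
    rw [add_sub_cancel_right] at h1 hC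
    rw [Chebyshev.C_add_two, derivative_sub, derivative_mul, derivative_X, h1, h0, hC,
      show (n : ℤ) + 2 - 1 = n + 1 by ring, hS]
    ring

/-- The Clebsch–Gordan sequence gives [V][Sym^{k+1} V] = [Sym^k V] + [Sym^{k+2} V], which is the
recurrence of the S_k; the base cases are Sym^0 V trivial and Sym^1 V = V. -/
theorem K0.aeval_chebyshev_S : ∀ k : ℕ,
    aeval (K0.mk SL2Rep.std) (Chebyshev.S ℤ k) = K0.mk (SL2Rep.symPow k)
  | 0 => by
    obtain ⟨e⟩ := SL2Rep.nonempty_trivial_equiv_symPow_zero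
    rw [← mk_eq_of_equiv e, mk_trivial]
    simp
  | 1 => by
    obtain ⟨e⟩ := SL2Rep.nonempty_std_equiv_symPow_one
    rw [← mk_eq_of_equiv e]
    simp
  | k + 2 => by
    have h := mk_eq_add (SL2Rep.isShortExact_clebschGordan k)
    have h1 := aeval_chebyshev_S (k + 1)
    rw [mk_tensor] at h
    push_cast at h1 ⊢
    rw [Chebyshev.S_add_two, map_sub, map_mul, aeval_X, h1, aeval_chebyshev_S k]
    linear_combination h

theorem K0.aeval_derivative_gamma {n : ℕ} {h : ℤ[X]} (hh : IsReciprocal n h) :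
    aeval (K0.mk SL2Rep.std) (derivative (shiftedReciprocal n (gammaPoly n h hh) (X + 2)))
      = ∑ j ∈ Finset.Icc 1 n, ((j : ℤ) * h.coeff (n - j)) • K0.mk (SL2Rep.symPow (j - 1)) := by
  rw [shiftedReciprocal_gammaPoly hh, derivative_add, derivative_C, zero_add, derivative_sum,
    map_sum]
  refine Finset.sum_congr rfl fun j hj => ?_
  have hj1 : ((j : ℤ) - 1) = ((j - 1 : ℕ) : ℤ) := by
    have := (Finset.mem_Icc.mp hj).1
    omega
  rw [derivative_C_mul, derivative_chebyshev_C, hj1, map_mul, map_mul, aeval_chebyshev_S,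
    map_natCast, zsmul_eq_mul]
  simp
  ring

theorem K0.aeval_derivative_gamma_of_nonneg {n : ℕ} {h : ℤ[X]} (hh : IsReciprocal n h)
    (hpos : ∀ k, 0 ≤ h.coeff k) :
    aeval (K0.mk SL2Rep.std) (derivative (shiftedReciprocal n (gammaPoly n h hh) (X + 2)))
      = K0.mk (SL2Rep.sumOfSymPow n fun j => j * (h.coeff (n - j)).toNat) := by
  rw [aeval_derivative_gamma, mk_sumOfSymPow]
  refine Finset.sum_congr rfl fun j _ => ?_
  rw [← natCast_zsmul, Nat.cast_mul, Int.toNat_of_nonneg (hpos _)]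

end GammaCheb

end

open GammaCheb in
theorem mainTheorem4 (n : ℕ) :
    -- Part 1
    (∀ (h : ℝ[X]) (hh : IsReciprocal n h) (V : Type*) (K : PreAbstractSimplicialComplex V),
      K.faces.Finite →
      FPoly K = C (h.coeff n) + ∑ j ∈ Finset.Icc 1 n, C (2 * h.coeff (n - j)) * X ^ j →
      ∀ L, IsTchebyshevTriangulation (skeleton n K) L →
        FPoly L = shiftedReciprocal n (gammaPoly n h hh) (2 * X + 2) ∧
        fPoly L = shiftedReciprocal n (gammaPoly n h hh) (2 * (2 * X + 1) + 2)) ∧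
    -- Part 2
    (∀ h : ℝ[X], IsReciprocal n h →
      let g : ℝ[X] := (chebExpansion n h.coeff).comp (2 * X)
      let gt : ℝ[X] := (chebExpansion n (reversedTuple n h.coeff)).comp (2 * X)
      let w : Fin (n + 1) → ℝ := (chebMatrix n).mulVec (coeffVec n gt)
      (IsTchebyshevFPolynomial g ↔ IsFPolynomial (ofCoeffVec n fun i => w i.rev)) ∧
      ∀ (V : Type*) (K : PreAbstractSimplicialComplex V), K.faces.Finite →
        ∀ L, IsTchebyshevTriangulation K L →
          (FPoly L = g ↔ FPoly K = ofCoeffVec n fun i => w i.rev)) ∧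
    -- Part 3
    (∀ (h : ℤ[X]) (hh : IsReciprocal n h),
      let D : ℤ[X] := derivative (shiftedReciprocal n (gammaPoly n h hh) (X + 2))
      aeval (K0.mk SL2Rep.std) D =
          ∑ j ∈ Finset.Icc 1 n, ((j : ℤ) * h.coeff (n - j)) • K0.mk (SL2Rep.symPow (j - 1)) ∧
      ((∀ k, 0 ≤ h.coeff k) →
        aeval (K0.mk SL2Rep.std) D =
          K0.mk (SL2Rep.sumOfSymPow n fun j => j * (h.coeff (n - j)).toNat))) ∧
    (∀ j ∈ Finset.Icc 1 n,
      LieModule.IsIrreducible ℂ sl2 (SL2Rep.symPow (j - 1)) ∧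
      Module.finrank ℂ (SL2Rep.symPow (j - 1)) = j) := by
  refine ⟨fun h hh V K hK hF L hL => tchebyshev_skeleton_gamma hh hK hF hL, fun h _ => ?_,
    fun h hh => ⟨K0.aeval_derivative_gamma hh, K0.aeval_derivative_gamma_of_nonneg hh⟩,
    fun j hj => ⟨SL2Rep.isIrreducible_symPow (j - 1), ?_⟩⟩
  · intro g gt w
    have hg : g = chebTransform (expansionPoly n h.coeff) := chebExpansion_comp_two_mul_X n h.coeff
    have hw : (ofCoeffVec n fun i => w i.rev) = expansionPoly n h.coeff :=
      ofCoeffVec_rev_chebMatrix_mulVec n h.coeff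
    -- Both claims now compare a polynomial with its image under the bijection `chebTransform`.
    rw [hg, hw]
    refine ⟨isTchebyshevFPolynomial_chebTransform_iff _, fun V K hK L hL => ?_⟩
    rw [FPoly_of_isTchebyshevTriangulation hK hL]
    exact chebTransform.injective.eq_iff
  · rw [SL2Rep.finrank_symPow]
    exact Nat.sub_add_cancel (Finset.mem_Icc.mp hj).1
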